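/- Let $\mathbb{D}=\{z\in\mathbb{C}:|z|<1\}$, and let $\mathcal{A}$ be the class of functions $f(z)=z+\sum_{n\ge1}a_{n+1}z^{n+1}$ that are analytic and univalent in $\mathbb{D}$. For $\kappa\neq0,-1,-2,\dots$ and $c\in\mathbb{C}\setminus\{0\}$ put $$B_{\kappa,c}(f)(z)=zu_{\kappa,c}(z)*f(z)=z+\sum_{n\ge1}a_{n+1}\frac{(-c/4)^n}{(\kappa)_n}\frac{z^{n+1}}{n!},\qquad u_{\kappa,c}(z)=\sum_{n\ge0}\frac{(-c/4)^n}{(\kappa)_n}\frac{z^n}{n!},$$ where $*$ is the Hadamard product and $(\kappa)_n=\kappa(\kappa+1)\cdots(\kappa+n-1)$; the function $B_{\kappa,c}(f)(z)/z$ is given its limit value $1$ at $z=0$. For $f,F$ analytic in $\mathbb{D}$ write $f\prec F$ if there is $w$ analytic in $\mathbb{D}$ with $|w(z)|\le|z|$ and $f(z)=F(w(z))$ for $z\in\mathbb{D}$. Let $\mathcal{H}[1,1]$ be the class of functions $f(z)=1+a_1z+a_2z^2+\cdots$ analytic in $\mathbb{D}$, and let $Q$ be the class of functions $f$ analytic and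 injective on $\overline{\mathbb{D}}\setminus E(f)$, where $E(f)=\{\zeta\in\partial\mathbb{D}:\lim_{z\to\zeta}f(z)=\infty\}$, with $f'(\zeta)\ne0$ for $\zeta\in\partial\mathbb{D}\setminus E(f)$. Let $f,g_1,g_2\in\mathcal{A}$, let $p,b\in\mathbb{R}$ be such that $\kappa=p+\frac{b+1}{2}>-1$, let $\lambda\in[0,1)$ and $c\in\mathbb{C}\setminus\{0\}$, and set $$\gamma_{\lambda,\kappa}=\frac{(1-\lambda)^2+(\kappa+1)^2-\sqrt{(1-\lambda)^4+(\kappa+1)^4}}{4(1-\lambda)(\kappa+1)}.$$ For $h\in\mathcal{A}$ write $$\Phi_h(z)=(1-\lambda)\frac{B_{\kappa+1,c}(h)(z)}{z}+\lambda\frac{B_{\kappa+2,c}(h)(z)}{z},\qquad \phi_h(z)=\frac{B_{\kappa+2,c}(h)(z)}{z}.$$ Suppose that, for $i=1,2$ and all $z\in\mathbb{D}$, $\Phi_{g_i}'(z)\neq0$ and $$\operatorname{Re}\left(1+\frac{z\Phi_{g_i}''(z)}{\Phi_{g_i}'(z)}\right)>-\gamma_{\lambda,\kappa},$$ that $\Phi_f$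 is univalent in $\mathbb{D}$, and that $\phi_f\in\mathcal{H}[1,1]\cap Q$. Then $$\Phi_{g_1}\prec\Phi_f\prec\Phi_{g_2}\quad\text{implies}\quad\phi_{g_1}\prec\phi_f\prec\phi_{g_2}.$$ Moreover, $\phi_{g_1}$ is the best subordinant of the differential superordination $$\Phi_{g_1}(z)\prec P(z)+\frac{1-\lambda}{\kappa+1}zP'(z),$$ and $\phi_{g_2}$ is the best dominant of the differential subordination $$P(z)+\frac{1-\lambda}{\kappa+1}zP'(z)\prec\Phi_{g_2}(z).$$ Here the solutions of the subordination are the functions $P$ analytic in $\mathbb{D}$ that satisfy it. A dominant is a univalent function $q$ with $P\prec q$ for every solution $P$, and the best dominant is a dominant $\tilde q$ with $\tilde q\prec q$ for every dominant $q$; these notions presuppose that the right-hand side $\Phi_{g_2}$ is univalent in $\mathbb{D}$, which is part of the claim. The solutions of the superordination are the functions $P$ univalent in $\mathbb{D}$ that satisfy it and for which $P(z)+\frac{1-\lambda}{\kappa+1}zP'(z)$ is univalent in $\mathbb{D}$. A subordinant is an analytic function $q$ with $q\prec P$ for every solution $P$, and the best subordinant is a univalent subordinant $\tilde q$ with $q\prec\tilde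 q$ for every subordinant $q$. -/

import Mathlib

open scoped Topology

/-! ### The class `𝒜`, subordination, the classes `ℋ[a, n]` and `Q`

Functions on the open unit disk `𝔻 = Metric.ball 0 1` are represented by total functions `ℂ → ℂ`;
only their values on `𝔻` matter. -/

/-- `f` is univalent in the open unit disk: analytic and injective there. -/
def UnivalentOnDisk (f : ℂ → ℂ) : Prop :=
  DifferentiableOn ℂ f (Metric.ball 0 1) ∧ Set.InjOn f (Metric.ball 0 1)

/-- The class `𝒜` of analytic univalent functions `f(z) = z + a₂ z² + …` in the unit disk. -/
def ClassA (f : ℂ → ℂ) : Prop :=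
  UnivalentOnDisk f ∧ f 0 = 0 ∧ deriv f 0 = 1

/-- The subordination `f ≺ F` on the unit disk: `f = F ∘ w` with `w` analytic, `|w(z)| ≤ |z|`. -/
def Subordinate (f F : ℂ → ℂ) : Prop :=
  ∃ w : ℂ → ℂ, DifferentiableOn ℂ w (Metric.ball 0 1) ∧
    ∀ z ∈ Metric.ball (0 : ℂ) 1, ‖w z‖ ≤ ‖z‖ ∧ f z = F (w z)

/-- The class `ℋ[a, n]` of analytic functions `f(z) = a + a_n zⁿ + a_{n+1} zⁿ⁺¹ + …` in the
unit disk. -/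
def ClassH (a : ℂ) (n : ℕ) (f : ℂ → ℂ) : Prop :=
  DifferentiableOn ℂ f (Metric.ball 0 1) ∧ f 0 = a ∧
    ∀ k : ℕ, 0 < k → k < n → iteratedDeriv k f 0 = 0

/-- The exceptional set `E(f)`: the points `ζ` of the unit circle with `f(z) → ∞` as `z → ζ`,
`z` in the open unit disk. -/
def exceptionalSet (f : ℂ → ℂ) : Set ℂ :=
  {ζ | ζ ∈ Metric.sphere (0 : ℂ) 1 ∧
    Filter.Tendsto f (𝓝[Metric.ball 0 1] ζ) (Bornology.cobounded ℂ)}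

/-- The class `Q`: `f` is analytic and injective on the closed unit disk minus `E(f)`, and
`f'(ζ) ≠ 0` at the points `ζ` of the unit circle outside `E(f)`. -/
def ClassQ (f : ℂ → ℂ) : Prop :=
  AnalyticOnNhd ℂ f (Metric.closedBall 0 1 \ exceptionalSet f) ∧
  Set.InjOn f (Metric.closedBall 0 1 \ exceptionalSet f) ∧
  ∀ ζ ∈ Metric.sphere (0 : ℂ) 1 \ exceptionalSet f, deriv f ζ ≠ 0

/-! ### First-order differential subordinations and superordinations -/

/-- `p` is a solution of the differential subordination `φ(p(z), z p'(z)) ≺ h(z)`. -/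
def SolvesSubordination (φ : ℂ → ℂ → ℂ) (h p : ℂ → ℂ) : Prop :=
  DifferentiableOn ℂ p (Metric.ball 0 1) ∧ Subordinate (fun z => φ (p z) (z * deriv p z)) h

/-- `q` is a dominant of `φ(p(z), z p'(z)) ≺ h(z)`. -/
def IsDominant (φ : ℂ → ℂ → ℂ) (h q : ℂ → ℂ) : Prop :=
  UnivalentOnDisk q ∧ ∀ p, SolvesSubordination φ h p → Subordinate p q

/-- `q` is the best dominant of `φ(p(z), z p'(z)) ≺ h(z)`, where `h` is univalent. -/
def IsBestDominant (φ : ℂ → ℂ → ℂ) (h q : ℂ → ℂ) : Prop :=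
  UnivalentOnDisk h ∧ IsDominant φ h q ∧ ∀ q', IsDominant φ h q' → Subordinate q q'

/-- `p` is a solution of the differential superordination `h(z) ≺ φ(p(z), z p'(z))`; both `p` and
`z ↦ φ(p(z), z p'(z))` are required to be univalent. -/
def SolvesSuperordination (φ : ℂ → ℂ → ℂ) (h p : ℂ → ℂ) : Prop :=
  UnivalentOnDisk p ∧ UnivalentOnDisk (fun z => φ (p z) (z * deriv p z)) ∧
    Subordinate h (fun z => φ (p z) (z * deriv p z))

/-- `q` is a subordinant of `h(z) ≺ φ(p(z), z p'(z))`. -/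
def IsSubordinant (φ : ℂ → ℂ → ℂ) (h q : ℂ → ℂ) : Prop :=
  DifferentiableOn ℂ q (Metric.ball 0 1) ∧ ∀ p, SolvesSuperordination φ h p → Subordinate q p

/-- `q` is the best subordinant of `h(z) ≺ φ(p(z), z p'(z))`, where `h` is analytic: a univalent
subordinant to which every subordinant is subordinate. -/
def IsBestSubordinant (φ : ℂ → ℂ → ℂ) (h q : ℂ → ℂ) : Prop :=
  DifferentiableOn ℂ h (Metric.ball 0 1) ∧ UnivalentOnDisk q ∧ IsSubordinant φ h q ∧
    ∀ q', IsSubordinant φ h q' → Subordinate q' q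

/-! ### The generalized Bessel operator -/

/-- The `n`-th Taylor coefficient of `f` at the origin. -/
noncomputable def taylorCoeffZero (f : ℂ → ℂ) (n : ℕ) : ℂ :=
  iteratedDeriv n f 0 / (n.factorial : ℂ)

/-- The Hadamard product (convolution) `F * G` of two power series at the origin. -/
noncomputable def hadamardProduct (F G : ℂ → ℂ) (z : ℂ) : ℂ :=
  ∑' n : ℕ, taylorCoeffZero F n * taylorCoeffZero G n * z ^ n

/-- The coefficient `(-c/4)ⁿ / ((κ)ₙ n!)`, with `(κ)ₙ = κ (κ + 1) ⋯ (κ + n - 1)`. -/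
noncomputable def besselCoeff (κ c : ℂ) (n : ℕ) : ℂ :=
  (-c / 4) ^ n / ((ascPochhammer ℂ n).eval κ * (n.factorial : ℂ))

/-- The normalized generalized Bessel function `u_{p,b,c}`, which depends on `p` and `b` only
through `κ = p + (b + 1) / 2`. -/
noncomputable def genBesselU (κ c : ℂ) (z : ℂ) : ℂ :=
  ∑' n : ℕ, besselCoeff κ c n * z ^ n

/-- The operator `B_{κ,c}(f) = z u_{p,b,c}(z) * f(z)`, where `*` is the Hadamard product. -/
noncomputable def besselOp (κ c : ℂ) (f : ℂ → ℂ) : ℂ → ℂ :=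
  hadamardProduct (fun z => z * genBesselU κ c z) f

/-- The function `z ↦ F(z) / z` for `F` with `F 0 = 0`, with its removable singularity at the
origin filled in. -/
noncomputable def overZ (F : ℂ → ℂ) (z : ℂ) : ℂ :=
  if z = 0 then deriv F 0 else F z / z

/-- The combination
`(1 - lam) B_{κ+1,c}(f)(z) / z + lam B_{κ+2,c}(f)(z) / z`. -/
noncomputable def besselComb (κ lam : ℝ) (c : ℂ) (f : ℂ → ℂ) (z : ℂ) : ℂ :=
  (1 - lam : ℂ) * overZ (besselOp (κ + 1) c f) z + (lam : ℂ) * overZ (besselOp (κ + 2) c f) z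

/-- The constant `γ_{lam,κ}`. -/
noncomputable def gammaConst (lam κ : ℝ) : ℝ :=
  ((1 - lam) ^ 2 + (κ + 1) ^ 2 - √((1 - lam) ^ 4 + (κ + 1) ^ 4)) / (4 * (1 - lam) * (κ + 1))

/-- `Φ' ≠ 0` and `Re (1 + z Φ''(z) / Φ'(z)) > -γ` in the unit disk. -/
def ConvexityCondition (γ : ℝ) (Φ : ℂ → ℂ) : Prop :=
  ∀ z ∈ Metric.ball (0 : ℂ) 1, deriv Φ z ≠ 0 ∧
    -γ < (1 + z * deriv (deriv Φ) z / deriv Φ z).re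

/-! ### The series of the operator -/

theorem summable_besselCoeff {κ : ℝ} (hκ : 0 < κ) (c z : ℂ) :
    Summable fun n : ℕ => ‖besselCoeff κ c n‖ * ‖z‖ ^ n := by
  have hpoch : ∀ n : ℕ, κ ^ n ≤ ‖(ascPochhammer ℂ n).eval (κ : ℂ)‖ := by
    intro n
    induction n with
    | zero => simp
    | succ n ih =>
      rw [ascPochhammer_succ_eval, norm_mul, pow_succ]
      have h1 : κ ≤ ‖(κ : ℂ) + n‖ := by
        have : ((κ : ℂ) + n) = ((κ + n : ℝ) : ℂ) := by push_cast; rfl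
        rw [this, Complex.norm_real, Real.norm_eq_abs, abs_of_pos (by positivity)]
        linarith [(Nat.cast_nonneg n : (0 : ℝ) ≤ n)]
      exact mul_le_mul ih h1 hκ.le (norm_nonneg _)
  refine Summable.of_nonneg_of_le (fun n => by positivity) (fun n => ?_)
    (Real.summable_pow_div_factorial (‖c / 4‖ / κ * ‖z‖))
  rw [besselCoeff, norm_div, norm_mul, norm_pow, neg_div, norm_neg, mul_pow, div_pow,
    Complex.norm_natCast]
  have h2 := hpoch n
  have h3 : 0 < κ ^ n := by positivity
  have h4 : (0 : ℝ) < n.factorial := by positivity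
  calc ‖c / 4‖ ^ n / (‖(ascPochhammer ℂ n).eval (κ : ℂ)‖ * n.factorial) * ‖z‖ ^ n
      ≤ ‖c / 4‖ ^ n / (κ ^ n * n.factorial) * ‖z‖ ^ n := by gcongr
    _ = ‖c / 4‖ ^ n / κ ^ n * ‖z‖ ^ n / n.factorial := by field_simp

theorem taylorCoeffZero_mul_genBesselU {κ : ℝ} (hκ : 0 < κ) (c : ℂ) (n : ℕ) :
    taylorCoeffZero (fun z => z * genBesselU κ c z) n =
      Nat.casesOn n 0 (besselCoeff κ c) := by
  let b : ℕ → ℂ := fun n => Nat.casesOn n 0 (besselCoeff κ c)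
  have hs : ∀ z : ℂ, HasSum (fun n => b n * z ^ n) (z * genBesselU κ c z) := by
    intro z
    have h0 : Summable fun n : ℕ => besselCoeff κ c n * z ^ n :=
      Summable.of_norm (by simpa using summable_besselCoeff hκ c z)
    have h1 := h0.hasSum.mul_left z
    rw [← hasSum_nat_add_iff' 1]
    simp only [Finset.range_one, Finset.sum_singleton]
    have e1 : (fun n => b (n + 1) * z ^ (n + 1)) =
        fun n => z * (besselCoeff κ c n * z ^ n) := by
      funext n
      simp only [b, pow_succ]
      ring
    have e2 : z * genBesselU κ c z - b 0 * z ^ 0 = z * ∑' n, besselCoeff κ c n * z ^ n := by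
      simp [b, genBesselU]
    rw [e1, e2]
    exact h1
  have hp : HasFPowerSeriesOnBall (fun z => z * genBesselU κ c z)
      (FormalMultilinearSeries.ofScalars ℂ b) 0 1 := by
    refine ⟨?_, one_pos, ?_⟩
    · have := FormalMultilinearSeries.le_radius_of_summable
        (FormalMultilinearSeries.ofScalars ℂ b) (r := 1) (by
          simp only [FormalMultilinearSeries.ofScalars_norm]
          rw [← summable_nat_add_iff 1]
          simpa [b] using summable_besselCoeff hκ c 1)
      simpa using this
    · intro y _
      have := hs y
      simp only [FormalMultilinearSeries.ofScalars_apply_eq, zero_add, smul_eq_mul]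
      exact this
  have hq := (hp.analyticAt).hasFPowerSeriesAt
  have he := hq.eq_formalMultilinearSeries hp.hasFPowerSeriesAt
  have := congrArg (fun p => FormalMultilinearSeries.coeff p n) he
  simpa [FormalMultilinearSeries.coeff_ofScalars, taylorCoeffZero, b] using this

/-- `B_{κ,c}(f)(z) = ∑ a_{n+1} (-c/4)ⁿ / ((κ)ₙ n!) zⁿ⁺¹`, where `a_n` are the Taylor coefficients
of `f`. -/
theorem besselOp_eq_tsum {κ : ℝ} (hκ : 0 < κ) (c : ℂ) (f : ℂ → ℂ) (z : ℂ) :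
    besselOp κ c f z =
      ∑' n : ℕ, taylorCoeffZero f (n + 1) * besselCoeff κ c n * z ^ (n + 1) := by
  unfold besselOp hadamardProduct
  simp only [taylorCoeffZero_mul_genBesselU hκ]
  rw [← (add_left_injective 1).tsum_eq (f := fun n : ℕ =>
    (Nat.casesOn n 0 (besselCoeff κ c) : ℂ) * taylorCoeffZero f n * z ^ n)]
  · exact tsum_congr fun n => by ring
  · intro n hn
    cases n with
    | zero => simp at hn
    | succ n => exact ⟨n, rfl⟩

/-!
Put `β = (1 - λ) / (κ + 1)` and `φ_h (z) = B_{κ+2,c}(h)(z) / z`. The recurrence for the Pochhammer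
symbols gives `Φ_h = φ_h + β z φ_h'`, so everything is a matter of the first order operator
`P ↦ P + β z P'`.

Under the hypothesis on `Φ = Φ_{g_i}` the function `q = φ_{g_i}` is convex, that is,
`Re (1 + z q'' / q') > 0` (`ConvexityCondition.of_add_mul_deriv`); this rests on Jack's lemma
(`exists_mul_deriv_eq_of_forall_norm_le`) and on `2 γ ≤ min β β⁻¹`.

For a convex `q` and `‖z‖ ≤ ‖w‖`, `z ≠ w`, both `w q'(w)` and `w q'(w) - z q'(z)` have nonnegative
real inner product with `q w - q z`, the former a positive one (`ConvexityCondition.support`,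
`ConvexityCondition.monotone_mul_deriv`). On circles this is the statement that the tangent of the
image curve turns monotonically and once; inside it follows from the maximum principle. Hence the
functions `q + τ z q'`, `τ ≥ 0`, are univalent and form a subordination chain
(`ConvexityCondition.add_mul_deriv_ne`, `ConvexityCondition.exists_add_mul_deriv_eq`), which takes
the place of the theory of Löwner chains.

If `P ≺ q` fails for a univalent `q`, Jack's lemma applied to `q⁻¹ ∘ P` yields points
`‖z‖ < ‖ζ‖` with `P z = q ζ` and `z P'(z) = m ζ q'(ζ)`, `m ≥ 1` (`subordinate_of_forall_ne`).
Used for the pair `(P, q)` this settles the subordination, and for the pair `(q, P)` the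
superordination: in both cases the chain property excludes such points. As `q` itself solves the
differential subordination and superordination, it is the best dominant and the best subordinant.
-/

/-! ### Inverses of univalent functions -/

theorem isOpen_image_of_forall_deriv_ne_zero {f : ℂ → ℂ} {U : Set ℂ} (hU : IsOpen U)
    (hf : DifferentiableOn ℂ f U) (hd : ∀ z ∈ U, deriv f z ≠ 0) : IsOpen (f '' U) := by
  rw [isOpen_iff_mem_nhds]
  rintro _ ⟨z, hz, rfl⟩
  have h := ((hf.analyticAt (hU.mem_nhds hz)).hasStrictDerivAt).map_nhds_eq (hd z hz)
  rw [← h]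
  exact Filter.image_mem_map (hU.mem_nhds hz)

namespace UnivalentOnDisk

variable {f : ℂ → ℂ}

theorem isOpen_image (hf : UnivalentOnDisk f) {s : Set ℂ} (hs : s ⊆ Metric.ball 0 1)
    (ho : IsOpen s) : IsOpen (f '' s) := by
  rcases (hf.1.analyticOnNhd Metric.isOpen_ball).is_constant_or_isOpen
    (convex_ball (0 : ℂ) 1).isPreconnected with ⟨w, hw⟩ | h
  · have h0 : (0 : ℂ) ∈ Metric.ball (0 : ℂ) 1 := by simp
    have h1 : (1 / 2 : ℂ) ∈ Metric.ball (0 : ℂ) 1 := by simp; norm_num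
    have := hf.2 h0 h1 ((hw _ h0).trans (hw _ h1).symm)
    norm_num at this
  · exact h s hs ho

/-- A univalent function has an analytic inverse. It is continuous by the open mapping theorem and
differentiable away from the isolated critical values, so these are removable. -/
theorem exists_inverse (hf : UnivalentOnDisk f) :
    ∃ g : ℂ → ℂ, DifferentiableOn ℂ g (f '' Metric.ball 0 1) ∧
      ∀ z ∈ Metric.ball (0 : ℂ) 1, g (f z) = z := by
  set D := Metric.ball (0 : ℂ) 1 with hD
  have hDo : IsOpen D := Metric.isOpen_ball
  set g := Function.invFunOn f D
  have hg : ∀ z ∈ D, g (f z) = z := fun z hz => hf.2.leftInvOn_invFunOn hz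
  have hfg : ∀ y ∈ f '' D, f (g y) = y := by
    rintro _ ⟨z, hz, rfl⟩
    rw [hg z hz]
  have himg : IsOpen (f '' D) := hf.isOpen_image subset_rfl hDo
  have hcont : ∀ z ∈ D, ContinuousAt g (f z) := by
    intro z hz
    rw [ContinuousAt, hg z hz]
    intro N hN
    obtain ⟨O, hON, hO, hzO⟩ := mem_nhds_iff.1 hN
    have h1 : f '' (O ∩ D) ∈ 𝓝 (f z) :=
      (hf.isOpen_image Set.inter_subset_right (hO.inter hDo)).mem_nhds ⟨z, ⟨hzO, hz⟩, rfl⟩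
    rw [Filter.mem_map]
    refine Filter.mem_of_superset h1 ?_
    rintro _ ⟨x, ⟨hxO, hxD⟩, rfl⟩
    simpa [hg x hxD] using hON hxO
  have hdiff : ∀ z ∈ D, deriv f z ≠ 0 → DifferentiableAt ℂ g (f z) := by
    intro z hz hne
    refine (HasDerivAt.of_local_left_inverse (f := f) (f' := deriv f z) (hcont z hz) ?_ hne
      ?_).differentiableAt
    · rw [hg z hz]
      exact (hf.1.differentiableAt (hDo.mem_nhds hz)).hasDerivAt
    · filter_upwards [himg.mem_nhds ⟨z, hz, rfl⟩] with y hy using hfg y hy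
  refine ⟨g, ?_, hg⟩
  rintro _ ⟨z, hz, rfl⟩
  refine (Complex.analyticAt_of_differentiable_on_punctured_nhds_of_continuousAt ?_
    (hcont z hz)).differentiableAt.differentiableWithinAt
  have han : AnalyticAt ℂ f z := hf.1.analyticAt (hDo.mem_nhds hz)
  rcases han.deriv.eventually_eq_zero_or_eventually_ne_zero with h0 | h1
  · -- a univalent function is not locally constant
    exfalso
    obtain ⟨ε, hε, hball⟩ := Metric.eventually_nhds_iff_ball.1 (h0.and (hDo.mem_nhds hz))
    have hdb : DifferentiableOn ℂ f (Metric.ball z ε) := hf.1.mono fun x hx => (hball x hx).2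
    have hw : z + (ε / 2 : ℝ) ∈ Metric.ball z ε := by
      simp [abs_of_pos hε, hε]
    have hEq : f (z + (ε / 2 : ℝ)) = f z := by
      refine (convex_ball z ε).is_const_of_fderivWithin_eq_zero hdb (fun x hx => ?_) hw
        (Metric.mem_ball_self hε)
      rw [fderivWithin_of_isOpen Metric.isOpen_ball hx]
      ext
      simpa using (hball x hx).1
    have := hf.2 (hball _ hw).2 hz hEq
    simp [hε.ne'] at this
  · have h2 : ∀ᶠ y in 𝓝[≠] f z, y ∈ f '' D ∧ deriv f (g y) ≠ 0 := by
      have hgt : Filter.Tendsto g (𝓝[≠] f z) (𝓝[≠] z) := by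
        refine tendsto_nhdsWithin_iff.2 ⟨?_, ?_⟩
        · have := hcont z hz
          rw [ContinuousAt, hg z hz] at this
          exact this.mono_left nhdsWithin_le_nhds
        · filter_upwards [self_mem_nhdsWithin, mem_nhdsWithin_of_mem_nhds
            (himg.mem_nhds ⟨z, hz, rfl⟩)] with y hy hyD hgy
          exact hy (by rw [Set.mem_singleton_iff, ← hfg y hyD, hgy])
      exact Filter.Eventually.and (mem_nhdsWithin_of_mem_nhds (himg.mem_nhds ⟨z, hz, rfl⟩))
        (hgt.eventually h1)
    filter_upwards [h2] with y hy
    obtain ⟨⟨x, hx, rfl⟩, hne⟩ := hy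
    rw [hg x hx] at hne
    exact hdiff x hx hne

end UnivalentOnDisk

/-! ### Jack's lemma and the lemma of Miller and Mocanu -/

theorem HasDerivAt.nonpos_of_forall_pos_le {ψ : ℝ → ℝ} {d : ℝ} (hd : HasDerivAt ψ d 0)
    (h : ∀ t, 0 < t → ψ t ≤ ψ 0) : d ≤ 0 := by
  refine le_of_tendsto hd.tendsto_slope_zero_right ?_
  filter_upwards [self_mem_nhdsWithin] with t ht
  rw [zero_add, smul_eq_mul]
  exact mul_nonpos_of_nonneg_of_nonpos (inv_nonneg.2 (le_of_lt ht)) (sub_nonpos.2 (h t ht))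

/-- **Jack's lemma**. By the Schwarz lemma, `‖f z‖ / ‖z‖` does not decrease along any path that runs
into `z₀` from inside the disk; the logarithmic spirals through `z₀` give the claim. -/
theorem exists_mul_deriv_eq_of_forall_norm_le {f : ℂ → ℂ} {z₀ : ℂ} (hz₀ : z₀ ≠ 0)
    (hf : DifferentiableOn ℂ f (Metric.ball 0 ‖z₀‖)) (hd : DifferentiableAt ℂ f z₀)
    (h0 : f 0 = 0) (hle : ∀ z ∈ Metric.ball (0 : ℂ) ‖z₀‖, ‖f z‖ ≤ ‖f z₀‖) (hne : f z₀ ≠ 0) :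
    ∃ m : ℝ, 1 ≤ m ∧ z₀ * deriv f z₀ = m * f z₀ := by
  have hr : 0 < ‖z₀‖ := norm_pos_iff.2 hz₀
  have hS : ∀ z ∈ Metric.ball (0 : ℂ) ‖z₀‖, ‖f z‖ ≤ ‖f z₀‖ / ‖z₀‖ * ‖z‖ := by
    intro z hz
    have := Complex.dist_le_div_mul_dist_of_mapsTo_ball (R₂ := ‖f z₀‖) hf
      (fun w hw => by simpa [h0] using hle w hw) hz
    simpa [h0] using this
  set k : ℂ := z₀ * deriv f z₀ / f z₀ with hk
  have hkf : z₀ * deriv f z₀ = k * f z₀ := by rw [hk, div_mul_cancel₀ _ hne]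
  have key : ∀ l : ℂ, l.re < 0 → (l * (k - 1)).re ≤ 0 := by
    intro l hl
    have hc : HasDerivAt (fun t : ℝ => z₀ * Complex.exp (l * t)) (z₀ * l) 0 := by
      have h1 : HasDerivAt (fun t : ℝ => l * (t : ℂ)) l 0 := by
        simpa using (Complex.ofRealCLM.hasDerivAt (x := (0 : ℝ))).const_mul l
      simpa using h1.cexp.const_mul z₀
    have hfc : HasDerivAt (fun t : ℝ => f (z₀ * Complex.exp (l * t)))
        (deriv f z₀ * (z₀ * l)) 0 := by
      have h2 : HasDerivAt f (deriv f z₀) (z₀ * Complex.exp (l * ((0 : ℝ) : ℂ))) := by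
        simpa using hd.hasDerivAt
      exact h2.comp (0 : ℝ) hc
    have hsq := hfc.norm_sq
    have hexp : HasDerivAt (fun t : ℝ => ‖f z₀‖ ^ 2 * Real.exp (2 * l.re * t))
        (‖f z₀‖ ^ 2 * (2 * l.re)) 0 := by
      have h1 : HasDerivAt (fun t : ℝ => 2 * l.re * t) (2 * l.re) 0 := by
        simpa using (hasDerivAt_id (0 : ℝ)).const_mul (2 * l.re)
      simpa using h1.exp.const_mul (‖f z₀‖ ^ 2)
    have hfin := (hsq.sub hexp).nonpos_of_forall_pos_le (fun t ht => ?_)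
    · have hin : deriv f z₀ * (z₀ * l) = l * k * f z₀ := by
        linear_combination l * hkf
      rw [hin, Complex.inner] at hfin
      have hre : (l * k * f z₀ *
          (starRingEnd ℂ) (f (z₀ * Complex.exp (l * ((0 : ℝ) : ℂ))))).re =
            ‖f z₀‖ ^ 2 * (l * k).re := by
        rw [show l * k * f z₀ * (starRingEnd ℂ) (f (z₀ * Complex.exp (l * ((0 : ℝ) : ℂ))))
          = (starRingEnd ℂ) (f z₀) * f z₀ * (l * k) by simp; ring, ← Complex.normSq_eq_conj_mul_self,
          Complex.re_ofReal_mul, Complex.normSq_eq_norm_sq]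
      rw [hre] at hfin
      have hpos : 0 < ‖f z₀‖ ^ 2 := by positivity
      rw [mul_sub, mul_one, Complex.sub_re]
      nlinarith
    · have hnorm : ‖z₀ * Complex.exp (l * t)‖ = ‖z₀‖ * Real.exp (l.re * t) := by
        rw [norm_mul, Complex.norm_exp]
        simp
      have hlt : Real.exp (l.re * t) < 1 := by
        rw [Real.exp_lt_one_iff]; exact mul_neg_of_neg_of_pos hl ht
      have hmem : z₀ * Complex.exp (l * t) ∈ Metric.ball (0 : ℂ) ‖z₀‖ := by
        rw [mem_ball_zero_iff, hnorm]
        exact mul_lt_of_lt_one_right hr hlt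
      have h1 := hS _ hmem
      rw [hnorm, ← mul_assoc, div_mul_cancel₀ _ hr.ne'] at h1
      have h2 : ‖f (z₀ * Complex.exp (l * t))‖ ^ 2 ≤ ‖f z₀‖ ^ 2 * Real.exp (2 * l.re * t) := by
        calc _ ≤ (‖f z₀‖ * Real.exp (l.re * t)) ^ 2 := by gcongr
          _ = _ := by rw [mul_pow, ← Real.exp_nat_mul]; ring_nf
      simpa using h2
  have hre : 1 ≤ k.re := by simpa using key (-1) (by simp)
  have him : k.im = 0 := by
    by_contra hne'
    have := key (-1 - (k.re / k.im : ℝ) * Complex.I) (by simp)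
    have h2 : (k.re / k.im) * k.im = k.re := div_mul_cancel₀ _ hne'
    simp at this
    linarith
  exact ⟨k.re, hre, by rw [hkf]; congr 1; exact Complex.ext (by simp) (by simp [him])⟩

/-- **The lemma of Miller and Mocanu**, in a form that asks for no regularity on the unit circle:
if the analytic function `P` is not subordinate to the univalent function `q`, then there are points
`z` and `ζ` of the disk, `‖z‖ < ‖ζ‖`, with `P z = q ζ` and `z P'(z) = m ζ q'(ζ)` for some `m ≥ 1`.
It is Jack's lemma for `q⁻¹ ∘ P` on the largest disk about the origin that `P` maps into the range
of `q`. -/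
theorem subordinate_of_forall_ne {P q : ℂ → ℂ} (hP : DifferentiableOn ℂ P (Metric.ball 0 1))
    (hq : UnivalentOnDisk q) (h0 : P 0 = q 0)
    (hne : ∀ z ∈ Metric.ball (0 : ℂ) 1, ∀ ζ ∈ Metric.ball (0 : ℂ) 1, ‖z‖ < ‖ζ‖ → P z = q ζ →
      ∀ m : ℝ, 1 ≤ m → z * deriv P z ≠ m * (ζ * deriv q ζ)) :
    Subordinate P q := by
  set D := Metric.ball (0 : ℂ) 1 with hD
  have hDo : IsOpen D := Metric.isOpen_ball
  have h0D : (0 : ℂ) ∈ D := by simp [hD]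
  obtain ⟨g, hg, hgq⟩ := hq.exists_inverse
  have himg : IsOpen (q '' D) := hq.isOpen_image subset_rfl hDo
  have hqg : ∀ y ∈ q '' D, g y ∈ D ∧ q (g y) = y := by
    rintro _ ⟨z, hz, rfl⟩
    rw [hgq z hz]
    exact ⟨hz, rfl⟩
  have hWd : ∀ z ∈ D, P z ∈ q '' D → DifferentiableAt ℂ (fun x => g (P x)) z := fun z hz hPz =>
    DifferentiableAt.comp z (hg.differentiableAt (himg.mem_nhds hPz))
      (hP.differentiableAt (hDo.mem_nhds hz))
  have hW0 : g (P 0) = 0 := by rw [h0, hgq 0 h0D]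
  have hA : ∀ r : ℝ, r ≤ 1 → (∀ z ∈ Metric.ball (0 : ℂ) r, P z ∈ q '' D) →
      ∀ z ∈ Metric.ball (0 : ℂ) r, ‖g (P z)‖ ≤ ‖z‖ := by
    intro r hr hPr z₁ hz₁
    have hsub : Metric.ball (0 : ℂ) r ⊆ D := Metric.ball_subset_ball hr
    by_contra! hlt
    have hz₁r : Metric.closedBall (0 : ℂ) ‖z₁‖ ⊆ Metric.ball 0 r := by
      intro x hx
      rw [mem_closedBall_zero_iff] at hx
      rw [mem_ball_zero_iff] at hz₁ ⊢
      exact hx.trans_lt hz₁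
    have hcont : ContinuousOn (fun x => ‖g (P x)‖) (Metric.closedBall (0 : ℂ) ‖z₁‖) := fun x hx =>
      (hWd x (hsub (hz₁r hx)) (hPr x (hz₁r hx))).continuousAt.norm.continuousWithinAt
    obtain ⟨z, hz, hmax⟩ := (isCompact_closedBall (0 : ℂ) ‖z₁‖).exists_isMaxOn
      ⟨0, by simp⟩ hcont
    have hzr := hz₁r hz
    have hlt' : ‖z‖ < ‖g (P z)‖ := by
      have h1 : ‖g (P z₁)‖ ≤ ‖g (P z)‖ := hmax (by simp)
      rw [mem_closedBall_zero_iff] at hz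
      linarith
    have hgz : g (P z) ≠ 0 := norm_pos_iff.1 ((norm_nonneg _).trans_lt hlt')
    have hz0 : z ≠ 0 := by
      rintro rfl
      exact hgz hW0
    have hbz : Metric.ball (0 : ℂ) ‖z‖ ⊆ Metric.closedBall 0 ‖z₁‖ :=
      Metric.ball_subset_closedBall.trans
        (Metric.closedBall_subset_closedBall (by simpa using hz))
    obtain ⟨m, hm, hmd⟩ := exists_mul_deriv_eq_of_forall_norm_le (f := fun x => g (P x)) hz0
      (fun x hx => (hWd x (hsub (hz₁r (hbz hx)))
        (hPr x (hz₁r (hbz hx)))).differentiableWithinAt)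
      (hWd z (hsub hzr) (hPr z hzr)) hW0 (fun x hx => hmax (hbz hx)) hgz
    obtain ⟨hgD, hqgz⟩ := hqg _ (hPr z hzr)
    refine hne z (hsub hzr) (g (P z)) hgD hlt' hqgz.symm m hm ?_
    have hder : deriv P z = deriv q (g (P z)) * deriv (fun x => g (P x)) z := by
      have h1 : HasDerivAt (fun x => q (g (P x)))
          (deriv q (g (P z)) * deriv (fun x => g (P x)) z) z :=
        HasDerivAt.comp z (hq.1.differentiableAt (hDo.mem_nhds hgD)).hasDerivAt
          (hWd z (hsub hzr) (hPr z hzr)).hasDerivAt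
      refine (h1.congr_of_eventuallyEq ?_).deriv
      filter_upwards [Metric.isOpen_ball.mem_nhds hzr] with x hx using (hqg _ (hPr x hx)).2.symm
    rw [hder]
    linear_combination deriv q (g (P z)) * hmd
  have hB : ∀ z ∈ D, P z ∈ q '' D := by
    by_contra! hS
    obtain ⟨z₁, hz₁, hPz₁⟩ := hS
    have hz₁' : ‖z₁‖ < 1 := mem_ball_zero_iff.1 hz₁
    have hcb : Metric.closedBall (0 : ℂ) ‖z₁‖ ⊆ D := Metric.closedBall_subset_ball hz₁'
    have hcl : IsClosed (Metric.closedBall (0 : ℂ) ‖z₁‖ ∩ P ⁻¹' (q '' D)ᶜ) :=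
      (hP.continuousOn.mono hcb).preimage_isClosed_of_isClosed Metric.isClosed_closedBall
        himg.isClosed_compl
    have hcpt : IsCompact (Metric.closedBall (0 : ℂ) ‖z₁‖ ∩ P ⁻¹' (q '' D)ᶜ) :=
      (isCompact_closedBall (0 : ℂ) ‖z₁‖).of_isClosed_subset hcl Set.inter_subset_left
    obtain ⟨z₀, ⟨hz₀b, hz₀⟩, hmin⟩ := hcpt.exists_isMinOn ⟨z₁, by simp, hPz₁⟩
      continuous_norm.continuousOn
    have hz₀D := hcb hz₀b
    have hPr : ∀ z ∈ Metric.ball (0 : ℂ) ‖z₀‖, P z ∈ q '' D := by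
      intro z hz
      by_contra hn
      rw [mem_ball_zero_iff] at hz
      rw [mem_closedBall_zero_iff] at hz₀b
      exact absurd (hmin ⟨by simpa using hz.le.trans hz₀b, hn⟩) (not_le.2 hz)
    have hz₀1 : ‖z₀‖ < 1 := mem_ball_zero_iff.1 hz₀D
    have hz₀0 : ‖z₀‖ ≠ 0 := by
      intro h
      rw [norm_eq_zero] at h
      subst h
      exact hz₀ ⟨0, h0D, h0.symm⟩
    have hWle := hA _ hz₀1.le hPr
    have hcb' : Metric.closedBall (0 : ℂ) ‖z₀‖ ⊆ D := Metric.closedBall_subset_ball hz₀1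
    have hK : IsClosed (q '' Metric.closedBall (0 : ℂ) ‖z₀‖) :=
      ((isCompact_closedBall (0 : ℂ) ‖z₀‖).image_of_continuousOn
        (hq.1.continuousOn.mono hcb')).isClosed
    have hmaps : Set.MapsTo P (Metric.ball (0 : ℂ) ‖z₀‖) (q '' Metric.closedBall (0 : ℂ) ‖z₀‖) := by
      intro z hz
      refine ⟨g (P z), ?_, (hqg _ (hPr z hz)).2⟩
      have h1 := hWle z hz
      rw [mem_ball_zero_iff] at hz
      simpa using h1.trans hz.le
    have hmem : P z₀ ∈ closure (q '' Metric.closedBall (0 : ℂ) ‖z₀‖) := by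
      refine ContinuousWithinAt.mem_closure
        ((hP.differentiableAt (hDo.mem_nhds hz₀D)).continuousAt.continuousWithinAt) ?_ hmaps
      rw [closure_ball _ hz₀0]
      simp
    rw [hK.closure_eq] at hmem
    exact hz₀ (Set.image_mono hcb' hmem)
  refine ⟨fun x => g (P x), fun z hz => (hWd z hz (hB z hz)).differentiableWithinAt, fun z hz =>
    ⟨hA 1 le_rfl hB z hz, (hqg _ (hB z hz)).2.symm⟩⟩

/-! ### Convexity of the solution of `φ + β z φ' = Φ` -/

/-- If `Re (1 + z Φ'' / Φ') > -γ` and `Φ = φ + β z φ'`, where `2 γ ≤ min β β⁻¹`, then `φ` is convex.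
With `p = 1 + z φ'' / φ'` the hypothesis reads `Re (p + β z p' / (1 + β p)) > -γ`. Were `Re p > 0` to
fail, Jack's lemma would apply to `(p - 1) / (p + 1) = z φ'' / (2 φ' + z φ'')`, a quotient which is
regular at zeros of `φ'`, at a point of least modulus where `Re p = 0`. -/
theorem ConvexityCondition.of_add_mul_deriv {φ Φ : ℂ → ℂ} {β γ : ℝ} (hβ : 0 < β)
    (hγ : 2 * γ ≤ β) (hγ' : 2 * γ * β ≤ 1) (hφ : DifferentiableOn ℂ φ (Metric.ball 0 1))
    (hΦ : ∀ z ∈ Metric.ball (0 : ℂ) 1, Φ z = φ z + β * (z * deriv φ z))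
    (hc : ConvexityCondition γ Φ) : ConvexityCondition 0 φ := by
  set D := Metric.ball (0 : ℂ) 1 with hD
  have hDo : IsOpen D := Metric.isOpen_ball
  have h0D : (0 : ℂ) ∈ D := by simp [hD]
  set s := deriv φ with hs
  have hsd : DifferentiableOn ℂ s D := hφ.deriv hDo
  have hsd' : DifferentiableOn ℂ (deriv s) D := hsd.deriv hDo
  have hat : ∀ {f : ℂ → ℂ}, DifferentiableOn ℂ f D → ∀ z ∈ D, HasDerivAt f (deriv f z) z :=
    fun hf z hz => (hf.differentiableAt (hDo.mem_nhds hz)).hasDerivAt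
  have hΦ1 : ∀ z ∈ D, deriv Φ z = (1 + β) * s z + β * (z * deriv s z) := by
    intro z hz
    have h1 : HasDerivAt (fun z => φ z + β * (z * s z)) _ z :=
      (hat hφ z hz).add (((hasDerivAt_id z).mul (hat hsd z hz)).const_mul (β : ℂ))
    have h2 : Φ =ᶠ[𝓝 z] fun z => φ z + β * (z * s z) := by
      filter_upwards [hDo.mem_nhds hz] with x hx using hΦ x hx
    rw [(h1.congr_of_eventuallyEq h2).deriv]
    simp only [id]
    ring
  have hΦ2 : ∀ z ∈ D, deriv (deriv Φ) z =
      (1 + 2 * β) * deriv s z + β * (z * deriv (deriv s) z) := by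
    intro z hz
    have h1 : HasDerivAt (fun z => (1 + β) * s z + β * (z * deriv s z)) _ z :=
      ((hat hsd z hz).const_mul ((1 : ℂ) + β)).add
        (((hasDerivAt_id z).mul (hat hsd' z hz)).const_mul (β : ℂ))
    have h2 : deriv Φ =ᶠ[𝓝 z] fun z => (1 + β) * s z + β * (z * deriv s z) := by
      filter_upwards [hDo.mem_nhds hz] with x hx using hΦ1 x hx
    rw [(h1.congr_of_eventuallyEq h2).deriv]
    simp only [id]
    ring
  have hnum : DifferentiableOn ℂ (fun z => z * deriv s z) D := differentiableOn_id.mul hsd'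
  have hden : DifferentiableOn ℂ (fun z => 2 * s z + z * deriv s z) D :=
    (hsd.const_mul 2).add hnum
  -- this says that `s z ≠ 0` and `Re p > 0`
  have hmain : ∀ z ∈ D, ‖z * deriv s z‖ < ‖2 * s z + z * deriv s z‖ := by
    by_contra! hS
    obtain ⟨z₁, hz₁, hle₁⟩ := hS
    have hz₁' : ‖z₁‖ < 1 := mem_ball_zero_iff.1 hz₁
    have hcb : Metric.closedBall (0 : ℂ) ‖z₁‖ ⊆ D := Metric.closedBall_subset_ball hz₁'
    have hcl : IsClosed (Metric.closedBall (0 : ℂ) ‖z₁‖ ∩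
        (fun z => ‖z * deriv s z‖ - ‖2 * s z + z * deriv s z‖) ⁻¹' Set.Ici 0) :=
      ContinuousOn.preimage_isClosed_of_isClosed
        ((hnum.continuousOn.mono hcb).norm.sub (hden.continuousOn.mono hcb).norm)
        Metric.isClosed_closedBall isClosed_Ici
    obtain ⟨z₀, ⟨hz₀b, hz₀⟩, hmin⟩ := ((isCompact_closedBall (0 : ℂ) ‖z₁‖).of_isClosed_subset hcl
      Set.inter_subset_left).exists_isMinOn ⟨z₁, by simp, by simpa using hle₁⟩
      continuous_norm.continuousOn
    have hz₀D := hcb hz₀b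
    have hz₀ : ‖2 * s z₀ + z₀ * deriv s z₀‖ ≤ ‖z₀ * deriv s z₀‖ := by simpa using hz₀
    have hz₀1 : ‖z₀‖ < 1 := mem_ball_zero_iff.1 hz₀D
    have hbD : Metric.ball (0 : ℂ) ‖z₀‖ ⊆ D := Metric.ball_subset_ball hz₀1.le
    have hlt : ∀ z ∈ Metric.ball (0 : ℂ) ‖z₀‖,
        ‖z * deriv s z‖ < ‖2 * s z + z * deriv s z‖ := by
      intro z hz
      by_contra! hn
      rw [mem_ball_zero_iff] at hz
      rw [mem_closedBall_zero_iff] at hz₀b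
      exact absurd (hmin ⟨by simpa using hz.le.trans hz₀b, by simpa using hn⟩) (not_le.2 hz)
    obtain ⟨hΦz, hre⟩ := hc z₀ hz₀D
    have hz₀0 : z₀ ≠ 0 := by
      rintro rfl
      have h1 : 2 * ‖s 0‖ ≤ 0 := by simpa using hz₀
      have h1 : s 0 = 0 := norm_le_zero_iff.1 (by linarith)
      exact hΦz (by rw [hΦ1 0 h0D, h1]; simp)
    have heq : ‖z₀ * deriv s z₀‖ = ‖2 * s z₀ + z₀ * deriv s z₀‖ := by
      refine le_antisymm ?_ hz₀
      have h1 : z₀ ∈ closure (Metric.ball (0 : ℂ) ‖z₀‖) := by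
        rw [closure_ball _ (norm_ne_zero_iff.2 hz₀0)]
        simp
      have hcl' : ContinuousOn (fun z => ‖z * deriv s z‖) D := hnum.continuousOn.norm
      have hcr' : ContinuousOn (fun z => ‖2 * s z + z * deriv s z‖) D := hden.continuousOn.norm
      exact ContinuousWithinAt.closure_le h1 ((hcl' z₀ hz₀D).mono hbD) ((hcr' z₀ hz₀D).mono hbD)
        fun z hz => (hlt z hz).le
    have hd0 : 2 * s z₀ + z₀ * deriv s z₀ ≠ 0 := by
      intro h
      have h1 : z₀ * deriv s z₀ = 0 := by rw [h, norm_zero] at heq; exact norm_eq_zero.1 heq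
      have h2 : s z₀ = 0 := by linear_combination (h - h1) / 2
      exact hΦz (by rw [hΦ1 z₀ hz₀D, h1, h2]; simp)
    have hn0 : z₀ * deriv s z₀ ≠ 0 := by
      rw [← norm_pos_iff, heq]
      exact norm_pos_iff.2 hd0
    have hJd : ∀ z ∈ D, 2 * s z + z * deriv s z ≠ 0 →
        HasDerivAt (fun z => z * deriv s z / (2 * s z + z * deriv s z))
          (((deriv s z + z * deriv (deriv s) z) * (2 * s z + z * deriv s z) -
            z * deriv s z * (2 * deriv s z + (deriv s z + z * deriv (deriv s) z))) /
              (2 * s z + z * deriv s z) ^ 2) z := by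
      intro z hz hne
      have h1 : HasDerivAt (fun z => z * deriv s z) (deriv s z + z * deriv (deriv s) z) z := by
        have h2 := (hasDerivAt_id z).mul (hat hsd' z hz)
        simp only [id, one_mul] at h2
        exact h2
      exact h1.div (((hat hsd z hz).const_mul 2).add h1) hne
    have hJ1 : ‖z₀ * deriv s z₀ / (2 * s z₀ + z₀ * deriv s z₀)‖ = 1 := by
      rw [norm_div, heq, div_self (norm_ne_zero_iff.2 hd0)]
    obtain ⟨m, hm, hmd⟩ := exists_mul_deriv_eq_of_forall_norm_le
      (f := fun z => z * deriv s z / (2 * s z + z * deriv s z)) hz₀0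
      (fun z hz => (hJd z (hbD hz) (norm_pos_iff.1 ((norm_nonneg _).trans_lt
        (hlt z hz)))).differentiableAt.differentiableWithinAt)
      (hJd z₀ hz₀D hd0).differentiableAt (by simp)
      (fun z hz => by
        rw [hJ1, norm_div]
        exact div_le_one_of_le₀ (hlt z hz).le (norm_nonneg _))
      (div_ne_zero hn0 hd0)
    rw [(hJd z₀ hz₀D hd0).deriv] at hmd
    rw [hΦ1 z₀ hz₀D, hΦ2 z₀ hz₀D] at hre
    rw [hΦ1 z₀ hz₀D] at hΦz
    generalize ha : z₀ * deriv s z₀ = a at *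
    generalize he : z₀ * (z₀ * deriv (deriv s) z₀) = e at *
    generalize s z₀ = σ at *
    have hmd' : 2 * σ * a + 2 * σ * e - 2 * a ^ 2 = m * (a * (2 * σ + a)) := by
      field_simp at hmd
      rw [← ha, ← he]
      rw [← ha] at hmd
      linear_combination hmd
    have hre' : -γ < (1 + ((1 + 2 * β) * a + β * e) / ((1 + β) * σ + β * a)).re := by
      rwa [← ha, ← he, show (1 + 2 * (β : ℂ)) * (z₀ * deriv s z₀) +
        β * (z₀ * (z₀ * deriv (deriv s) z₀)) = z₀ * ((1 + 2 * β) * deriv s z₀ +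
          β * (z₀ * deriv (deriv s) z₀)) by ring, ha]
    by_cases hσ : σ = 0
    · -- a zero of `φ'`: there the equation would force `m = -2`
      subst hσ
      have h1 : ((m + 2 : ℝ) : ℂ) * a ^ 2 = 0 := by push_cast; linear_combination -hmd'
      rcases mul_eq_zero.1 h1 with h | h
      · rw [Complex.ofReal_eq_zero] at h
        linarith
      · exact hn0 (pow_eq_zero_iff two_ne_zero |>.1 h)
    · obtain ⟨p, hp⟩ : ∃ p, a = (p - 1) * σ := ⟨a / σ + 1, by field_simp; ring⟩
      have hpre : p.re = 0 := by
        have h1 : ‖p - 1‖ = ‖p + 1‖ := by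
          rw [hp, show 2 * σ + (p - 1) * σ = (p + 1) * σ by ring, norm_mul, norm_mul] at heq
          exact mul_right_cancel₀ (norm_ne_zero_iff.2 hσ) heq
        have h2 : ‖p - 1‖ ^ 2 = ‖p + 1‖ ^ 2 := by rw [h1]
        rw [← Complex.normSq_eq_norm_sq, ← Complex.normSq_eq_norm_sq, Complex.normSq_apply,
          Complex.normSq_apply] at h2
        simp at h2
        linarith
      set y := p.im
      have hpy : p = y * Complex.I := Complex.ext (by simp [hpre]) (by simp [y])
      have hden0 : (1 : ℂ) + β * p ≠ 0 := by
        intro h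
        have := congrArg Complex.re h
        simp [hpre] at this
      have hval : 1 + ((1 + 2 * β) * a + β * e) / ((1 + β) * σ + β * a) =
          p + β * m * (p ^ 2 - 1) / (2 * (1 + β * p)) := by
        have h1 : (1 + β) * σ + β * a = σ * (1 + β * p) := by rw [hp]; ring
        have h2 : e = σ * ((p - 1) ^ 2 - (p - 1) + m * (p ^ 2 - 1) / 2) := by
          rw [hp] at hmd'
          have h3 : (2 * σ) * (e - σ * ((p - 1) ^ 2 - (p - 1) + m * (p ^ 2 - 1) / 2)) = 0 := by
            linear_combination hmd'
          exact sub_eq_zero.1 ((mul_eq_zero.1 h3).resolve_left (by simpa using hσ))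
        rw [h1, h2, hp]
        field_simp
        ring
      have hre2 : (p + β * m * (p ^ 2 - 1) / (2 * (1 + β * p))).re =
          -(β * m * (1 + y ^ 2)) / (2 * (1 + β ^ 2 * y ^ 2)) := by
        have h1 : (1 + β ^ 2 * y ^ 2 : ℝ) ≠ 0 := by positivity
        have h1' : (1 + β ^ 2 * y ^ 2 : ℂ) ≠ 0 := by exact_mod_cast h1
        have h2 : β * m * (p ^ 2 - 1) / (2 * (1 + β * p)) =
            ((-(β * m * (1 + y ^ 2)) / (2 * (1 + β ^ 2 * y ^ 2)) : ℝ) : ℂ) * (1 - β * p) := by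
          push_cast
          rw [div_mul_eq_mul_div, div_eq_div_iff (by simpa using hden0) (by simpa using h1')]
          have hp2 : p ^ 2 = -y ^ 2 := by rw [hpy, mul_pow, Complex.I_sq]; ring
          linear_combination (2 * (β * m * (1 + β ^ 2 * y ^ 2)) -
            2 * (β * m * (1 + y ^ 2)) * β ^ 2) * hp2
        rw [h2, Complex.add_re, Complex.re_ofReal_mul]
        simp [hpre]
      rw [hval, hre2] at hre'
      have hpos : 0 < 2 * (1 + β ^ 2 * y ^ 2) := by positivity
      rw [lt_div_iff₀ hpos] at hre'
      have hy := sq_nonneg y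
      have h1 : 2 * γ * β * (β * y ^ 2) ≤ 1 * (β * y ^ 2) :=
        mul_le_mul_of_nonneg_right hγ' (by positivity)
      have h2 : 0 ≤ (m - 1) * (β * (1 + y ^ 2)) :=
        mul_nonneg (by linarith) (by positivity)
      nlinarith
  intro z hz
  have hlt := hmain z hz
  have hsz : s z ≠ 0 := by
    intro h
    simp [h] at hlt
  refine ⟨hsz, ?_⟩
  obtain ⟨p, hp⟩ : ∃ p, z * deriv s z = (p - 1) * s z :=
    ⟨z * deriv s z / s z + 1, by field_simp; ring⟩
  have h1 : 1 + z * deriv s z / s z = p := by rw [hp]; field_simp; ring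
  rw [h1]
  rw [hp, show 2 * s z + (p - 1) * s z = (p + 1) * s z by ring, norm_mul, norm_mul] at hlt
  have h2 : ‖p - 1‖ ^ 2 < ‖p + 1‖ ^ 2 := by
    have := lt_of_mul_lt_mul_right hlt (norm_nonneg _)
    gcongr
  rw [← Complex.normSq_eq_norm_sq, ← Complex.normSq_eq_norm_sq, Complex.normSq_apply,
    Complex.normSq_apply] at h2
  simp at h2
  linarith

/-! ### Two-point estimates for convex functions -/

/-- The minimum principle for the real part. -/
theorem Complex.re_nonneg_of_forall_sphere {g : ℂ → ℂ} {r : ℝ} (hr : 0 < r)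
    (hg : DiffContOnCl ℂ g (Metric.ball 0 r))
    (h : ∀ ζ ∈ Metric.sphere (0 : ℂ) r, 0 ≤ (g ζ).re) {z : ℂ} (hz : z ∈ Metric.ball (0 : ℂ) r) :
    0 ≤ (g z).re := by
  have hE : DiffContOnCl ℂ (fun z => Complex.exp (-g z)) (Metric.ball 0 r) :=
    Complex.differentiable_exp.comp_diffContOnCl hg.neg
  have := Complex.norm_le_of_forall_mem_frontier_norm_le Metric.isBounded_ball hE (C := 1)
    (fun ζ hζ => by
      rw [frontier_ball _ hr.ne'] at hζ
      rw [Complex.norm_exp, Real.exp_le_one_iff]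
      simpa using h ζ hζ) (subset_closure hz)
  rw [Complex.norm_exp, Real.exp_le_one_iff] at this
  simpa using this

namespace ConvexityCondition

variable {q : ℂ → ℂ}

/-- The tangent of the curve `θ ↦ q (w e^{iθ})` turns monotonically, with derivative
`Re (1 + ζ q''(ζ) / q'(ζ)) > 0` and, by the mean value property, through `2π` in all. The height of
the curve below its tangent line at `w` therefore first increases and then decreases back to `0`,
and is positive in between. -/
theorem support_on_circle (hc : ConvexityCondition 0 q)
    (hq : DifferentiableOn ℂ q (Metric.ball 0 1)) {w : ℂ} (hw : ‖w‖ < 1) (hw0 : w ≠ 0) {η : ℝ}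
    (h0 : 0 < η) (h1 : η < 2 * Real.pi) :
    0 < (starRingEnd ℂ (w * deriv q w) * (q w - q (w * Complex.exp (η * Complex.I)))).re := by
  set D := Metric.ball (0 : ℂ) 1 with hD
  have hDo : IsOpen D := Metric.isOpen_ball
  have h0D : (0 : ℂ) ∈ D := by simp [hD]
  set s := deriv q with hs
  have hsd : DifferentiableOn ℂ s D := hq.deriv hDo
  have hsd' : DifferentiableOn ℂ (deriv s) D := hsd.deriv hDo
  have hat : ∀ {f : ℂ → ℂ}, DifferentiableOn ℂ f D → ∀ z ∈ D, HasDerivAt f (deriv f z) z :=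
    fun hf z hz => (hf.differentiableAt (hDo.mem_nhds hz)).hasDerivAt
  set p : ℂ → ℂ := fun z => 1 + z * deriv s z / s z with hp
  have hpd : DifferentiableOn ℂ p D :=
    (differentiableOn_const 1).add ((differentiableOn_id.mul hsd').div hsd fun z hz => (hc z hz).1)
  have hppos : ∀ z ∈ D, 0 < (p z).re := fun z hz => by
    have := (hc z hz).2
    rwa [neg_zero] at this
  set c : ℝ → ℂ := fun θ => w * Complex.exp (θ * Complex.I) with hcdef
  have hcD : ∀ θ, c θ ∈ D := fun θ => by
    rw [mem_ball_zero_iff, hcdef]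
    simpa [Complex.norm_exp_ofReal_mul_I] using hw
  have hcc : ∀ θ, HasDerivAt c (c θ * Complex.I) θ := by
    intro θ
    have h1 : HasDerivAt (fun t : ℝ => (t : ℂ) * Complex.I) Complex.I θ := by
      simpa using (Complex.ofRealCLM.hasDerivAt (x := θ)).mul_const Complex.I
    simpa [hcdef, mul_assoc] using h1.cexp.const_mul w
  have hc0 : c 0 = w := by simp [hcdef]
  have hpc : Continuous fun θ => p (c θ) :=
    continuous_iff_continuousAt.2 fun θ =>
      ContinuousAt.comp (f := c) ((hpd.differentiableAt (hDo.mem_nhds (hcD θ))).continuousAt)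
        (hcc θ).continuousAt
  set A : ℝ → ℂ := fun θ => ∫ t in (0 : ℝ)..θ, p (c t) with hA
  have hAd : ∀ θ, HasDerivAt A (p (c θ)) θ := fun θ =>
    intervalIntegral.integral_hasDerivAt_right (hpc.intervalIntegrable _ _)
      (hpc.stronglyMeasurableAtFilter _ _) hpc.continuousAt
  have hA0 : A 0 = 0 := by simp [hA]
  have hA2 : A (2 * Real.pi) = 2 * Real.pi := by
    have hmul : DifferentiableOn ℂ (fun x => p (w * x)) (Metric.ball 0 ‖w‖⁻¹) := by
      refine hpd.comp (differentiableOn_id.const_mul w) fun x hx => ?_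
      rw [mem_ball_zero_iff] at hx ⊢
      simp only [norm_mul]
      calc ‖w‖ * ‖x‖ < ‖w‖ * ‖w‖⁻¹ := by gcongr
        _ = 1 := mul_inv_cancel₀ (norm_ne_zero_iff.2 hw0)
    have hw1 : 1 < ‖w‖⁻¹ := (one_lt_inv₀ (norm_pos_iff.2 hw0)).2 hw
    have hd : DiffContOnCl ℂ (fun x => p (w * x)) (Metric.ball 0 |1|) := by
      rw [abs_one]
      exact (hmul.mono (Metric.closedBall_subset_ball hw1)).diffContOnCl_ball subset_rfl
    have h2 := hd.circleAverage
    rw [Real.circleAverage_def] at h2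
    simp only [circleMap, zero_add, Complex.ofReal_one, one_mul, mul_zero] at h2
    have h3 : p 0 = 1 := by simp [hp]
    rw [h3, Complex.real_smul] at h2
    have h4 : ((2 * Real.pi : ℝ) : ℂ) ≠ 0 := by
      exact_mod_cast Real.two_pi_pos.ne'
    rw [hA]
    have h5 : (∫ t in (0 : ℝ)..(2 * Real.pi), p (c t)) = ((2 * Real.pi : ℝ) : ℂ) := by
      rw [Complex.ofReal_inv, inv_mul_eq_iff_eq_mul₀ h4, mul_one] at h2
      exact h2
    simp only [h5]
    push_cast
    ring
  set τ₀ : ℂ := w * s w with hτ₀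
  have hτ₀0 : τ₀ ≠ 0 := mul_ne_zero hw0 (hc w (by simpa [hD] using hw)).1
  -- `τ θ = c θ * q'(c θ)` is `-i` times the tangent, and solves `τ' = i p(c θ) τ`
  have hτ : ∀ θ, c θ * s (c θ) = τ₀ * Complex.exp (A θ * Complex.I) := by
    have hder : ∀ θ, HasDerivAt
        (fun θ => c θ * s (c θ) * Complex.exp (-(A θ * Complex.I))) 0 θ := by
      intro θ
      have h2 : HasDerivAt (fun θ => s (c θ)) (deriv s (c θ) * (c θ * Complex.I)) θ :=
        (hat hsd (c θ) (hcD θ)).comp θ (hcc θ)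
      have h3 := ((hcc θ).mul h2).mul (((hAd θ).mul_const Complex.I).neg.cexp)
      refine h3.congr_deriv ?_
      have h4 : s (c θ) ≠ 0 := (hc _ (hcD θ)).1
      simp only [hp, Pi.mul_apply]
      field_simp
      ring
    intro θ
    have h5 := is_const_of_deriv_eq_zero (fun θ => (hder θ).differentiableAt)
      (fun θ => (hder θ).deriv) θ 0
    simp only [hA0, hc0] at h5
    rw [Complex.exp_neg] at h5
    have h6 := Complex.exp_ne_zero (A θ * Complex.I)
    field_simp at h5
    rw [h5, hτ₀]
    simp
    ring
  set F : ℝ → ℝ := fun θ => (starRingEnd ℂ τ₀ * (q w - q (c θ))).re with hF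
  have hFd : ∀ θ, HasDerivAt F
      (Complex.normSq τ₀ * Real.exp (-(A θ).im) * Real.sin (A θ).re) θ := by
    intro θ
    have h2 : HasDerivAt (fun θ => q (c θ)) (s (c θ) * (c θ * Complex.I)) θ :=
      (hat hq (c θ) (hcD θ)).comp θ (hcc θ)
    have h3 := Complex.reCLM.hasFDerivAt.comp_hasDerivAt θ
      ((h2.const_sub (q w)).const_mul (starRingEnd ℂ τ₀))
    refine h3.congr_deriv ?_
    rw [show s (c θ) * (c θ * Complex.I) = c θ * s (c θ) * Complex.I by ring, hτ θ]
    rw [show starRingEnd ℂ τ₀ * -(τ₀ * Complex.exp (A θ * Complex.I) * Complex.I) =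
      starRingEnd ℂ τ₀ * τ₀ * -(Complex.exp (A θ * Complex.I) * Complex.I) by ring,
      ← Complex.normSq_eq_conj_mul_self, Complex.reCLM_apply, Complex.re_ofReal_mul, mul_assoc]
    simp [Complex.exp_im]
  have hFc : Continuous F := continuous_iff_continuousAt.2 fun θ => (hFd θ).continuousAt
  have hmono : StrictMono fun θ => (A θ).re := by
    refine strictMono_of_deriv_pos fun θ => ?_
    have h2 : HasDerivAt (fun θ => (A θ).re) (p (c θ)).re θ :=
      Complex.reCLM.hasFDerivAt.comp_hasDerivAt θ (hAd θ)
    rw [h2.deriv]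
    exact hppos _ (hcD θ)
  have hA0' : (A 0).re = 0 := by rw [hA0]; simp
  have hA2' : (A (2 * Real.pi)).re = 2 * Real.pi := by rw [hA2]; simp
  have hpos : ∀ θ, 0 < Complex.normSq τ₀ * Real.exp (-(A θ).im) := fun θ =>
    mul_pos (Complex.normSq_pos.2 hτ₀0) (Real.exp_pos _)
  change 0 < F η
  rcases le_total (A η).re Real.pi with hle | hle
  · have hF0 : F 0 = 0 := by simp [hF, hc0]
    have := strictMonoOn_of_deriv_pos (convex_Icc 0 η) hFc.continuousOn (fun θ hθ => by
      rw [interior_Icc] at hθ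
      rw [(hFd θ).deriv]
      refine mul_pos (hpos θ) (Real.sin_pos_of_pos_of_lt_pi ?_ ?_)
      · rw [← hA0']; exact hmono hθ.1
      · exact (hmono hθ.2).trans_le hle)
    rw [← hF0]
    exact this (by simp [h0.le]) (by simp [h0.le]) h0
  · have hF2 : F (2 * Real.pi) = 0 := by
      have : c (2 * Real.pi) = w := by
        simp [hcdef]
      simp [hF, this]
    have := strictAntiOn_of_deriv_neg (convex_Icc η (2 * Real.pi)) hFc.continuousOn (fun θ hθ => by
      rw [interior_Icc] at hθ
      rw [(hFd θ).deriv]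
      refine mul_neg_of_pos_of_neg (hpos θ) ?_
      have h2 := hle.trans_lt (hmono hθ.1)
      have h3 := hmono hθ.2
      simp only [hA2'] at h3
      rw [← Real.sin_sub_two_pi]
      exact Real.sin_neg_of_neg_of_neg_pi_lt (by linarith) (by linarith))
    rw [← hF2]
    exact this (by simp [h1.le]) (by simp [h1.le]) h1

theorem support_of_norm_eq (hc : ConvexityCondition 0 q)
    (hq : DifferentiableOn ℂ q (Metric.ball 0 1)) {z w : ℂ} (hw : ‖w‖ < 1) (hzw : ‖z‖ = ‖w‖)
    (hne : z ≠ w) : 0 < (starRingEnd ℂ (w * deriv q w) * (q w - q z)).re := by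
  have hw0 : w ≠ 0 := by
    rintro rfl
    exact hne (by simpa using hzw)
  set η := toIcoMod Real.two_pi_pos 0 (z / w).arg with hη
  have hexp : Complex.exp (η * Complex.I) = z / w := by
    have h1 : ‖z / w‖ = 1 := by rw [norm_div, hzw, div_self (norm_ne_zero_iff.2 hw0)]
    have h2 : η = (z / w).arg - toIcoDiv Real.two_pi_pos 0 (z / w).arg * (2 * Real.pi) := by
      rw [hη, toIcoMod, zsmul_eq_mul]
    have h3 : (η : ℂ) * Complex.I = (z / w).arg * Complex.I -
        toIcoDiv Real.two_pi_pos 0 (z / w).arg * (2 * Real.pi * Complex.I) := by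
      rw [h2]; push_cast; ring
    rw [h3, Complex.exp_sub, Complex.exp_int_mul_two_pi_mul_I, div_one]
    have := Complex.norm_mul_exp_arg_mul_I (z / w)
    rwa [h1, Complex.ofReal_one, one_mul] at this
  have hmem := toIcoMod_mem_Ico Real.two_pi_pos 0 (z / w).arg
  rw [← hη, zero_add] at hmem
  have hη0 : 0 < η := by
    refine lt_of_le_of_ne hmem.1 fun h => hne ?_
    rw [← h] at hexp
    simp only [Complex.ofReal_zero, zero_mul, Complex.exp_zero] at hexp
    field_simp at hexp
    exact hexp.symm
  have := hc.support_on_circle hq hw hw0 hη0 hmem.2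
  rwa [hexp, mul_div_cancel₀ _ hw0] at this

/-- A convex function maps the disk of radius `‖w‖` to one side of the line through `q w` that is
orthogonal to `w q'(w)`. -/
theorem support (hc : ConvexityCondition 0 q) (hq : DifferentiableOn ℂ q (Metric.ball 0 1))
    {z w : ℂ} (hw : ‖w‖ < 1) (hzw : ‖z‖ ≤ ‖w‖) (hne : z ≠ w) :
    0 < (starRingEnd ℂ (w * deriv q w) * (q w - q z)).re := by
  rcases hzw.lt_or_eq with hlt | heq
  · have hr : 0 < ‖w‖ := (norm_nonneg _).trans_lt hlt
    have hsub : Metric.closedBall (0 : ℂ) ‖w‖ ⊆ Metric.ball 0 1 := Metric.closedBall_subset_ball hw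
    have hwD : w ∈ Metric.ball (0 : ℂ) 1 := mem_ball_zero_iff.2 hw
    set τ := w * deriv q w with hτ
    have hτ0 : τ ≠ 0 := mul_ne_zero (norm_pos_iff.1 hr) (hc w hwD).1
    have hnn : ∀ ζ ∈ Metric.ball (0 : ℂ) ‖w‖, 0 ≤ (starRingEnd ℂ τ * (q w - q ζ)).re := by
      intro ζ hζ
      refine Complex.re_nonneg_of_forall_sphere (g := fun ζ => starRingEnd ℂ τ * (q w - q ζ)) hr
        ?_ ?_ hζ
      · exact (((hq.mono hsub).const_sub (q w)).const_mul (starRingEnd ℂ τ)).diffContOnCl_ball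
          subset_rfl
      · intro x hx
        rw [mem_sphere_zero_iff_norm] at hx
        rcases eq_or_ne x w with rfl | hxw
        · simp
        · exact (hc.support_of_norm_eq hq hw hx hxw).le
    -- strictness: the range of `q` on the open disk is open
    have hopen : IsOpen (q '' Metric.ball (0 : ℂ) ‖w‖) :=
      isOpen_image_of_forall_deriv_ne_zero Metric.isOpen_ball
        (hq.mono (Metric.ball_subset_closedBall.trans hsub))
        fun x hx => (hc x (hsub (Metric.ball_subset_closedBall hx))).1
    have hcont : Filter.Tendsto (fun t : ℝ => q z + t * τ) (𝓝[>] 0) (𝓝 (q z)) := by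
      have : Continuous fun t : ℝ => q z + t * τ := by fun_prop
      simpa using (this.tendsto 0).mono_left nhdsWithin_le_nhds
    have hev := hcont.eventually (hopen.mem_nhds ⟨z, mem_ball_zero_iff.2 hlt, rfl⟩)
    obtain ⟨t, ⟨x, hx, hxt⟩, ht⟩ := (hev.and self_mem_nhdsWithin).exists
    have h1 := hnn x hx
    rw [hxt, show starRingEnd ℂ τ * (q w - (q z + t * τ)) =
      starRingEnd ℂ τ * (q w - q z) - (t : ℂ) * (starRingEnd ℂ τ * τ) by ring,
      ← Complex.normSq_eq_conj_mul_self, Complex.sub_re, Complex.re_ofReal_mul,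
      Complex.ofReal_re] at h1
    have h2 : 0 < t * Complex.normSq τ := mul_pos ht (Complex.normSq_pos.2 hτ0)
    linarith
  · exact hc.support_of_norm_eq hq hw heq hne

/-- On circles this is the sum of two instances of `support`; inside it follows from the minimum
principle for the quotient of the two difference quotients, whose value at `w` is
`1 + w q''(w) / q'(w)`. -/
theorem monotone_mul_deriv (hc : ConvexityCondition 0 q)
    (hq : DifferentiableOn ℂ q (Metric.ball 0 1)) {z w : ℂ} (hw : ‖w‖ < 1) (hzw : ‖z‖ ≤ ‖w‖) :
    0 ≤ (starRingEnd ℂ (q w - q z) * (w * deriv q w - z * deriv q z)).re := by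
  have hcirc : ∀ x : ℂ, ‖x‖ = ‖w‖ →
      0 ≤ (starRingEnd ℂ (q w - q x) * (w * deriv q w - x * deriv q x)).re := by
    intro x hx
    rcases eq_or_ne x w with rfl | hxw
    · simp
    · have h1 := hc.support_of_norm_eq hq hw hx hxw
      have h2 := hc.support_of_norm_eq hq (hx.symm ▸ hw) hx.symm hxw.symm
      simp only [Complex.mul_re, Complex.conj_re, Complex.conj_im, Complex.sub_re,
        Complex.sub_im] at h1 h2 ⊢
      linarith
  rcases hzw.lt_or_eq with hlt | heq
  · have hr : 0 < ‖w‖ := (norm_nonneg _).trans_lt hlt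
    have hDo : IsOpen (Metric.ball (0 : ℂ) 1) := Metric.isOpen_ball
    have hsub : Metric.closedBall (0 : ℂ) ‖w‖ ⊆ Metric.ball 0 1 := Metric.closedBall_subset_ball hw
    have hwD : w ∈ Metric.ball (0 : ℂ) 1 := mem_ball_zero_iff.2 hw
    set T : ℂ → ℂ := fun z => z * deriv q z with hT
    have hTd : DifferentiableOn ℂ T (Metric.ball 0 1) := differentiableOn_id.mul (hq.deriv hDo)
    have hq0 : ∀ x ∈ Metric.closedBall (0 : ℂ) ‖w‖, dslope q w x ≠ 0 := by
      intro x hx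
      rcases eq_or_ne x w with rfl | hxw
      · rw [dslope_same]
        exact (hc _ hwD).1
      · rw [dslope_of_ne _ hxw, slope_def_field]
        refine div_ne_zero (fun h => ?_) (sub_ne_zero.2 hxw)
        have := hc.support hq hw (by simpa using hx) hxw
        rw [← neg_sub, h] at this
        simp at this
    have hquot : ∀ x, x ≠ w → dslope T w x / dslope q w x =
        (T w - T x) / (q w - q x) := by
      intro x hx
      rw [dslope_of_ne _ hx, dslope_of_ne _ hx, slope_def_field, slope_def_field,
        div_div_div_cancel_right₀ (sub_ne_zero.2 hx), ← neg_sub, ← neg_sub (q w), neg_div_neg_eq]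
    have hmr : ∀ a b : ℂ, (a / b).re = (starRingEnd ℂ b * a).re / Complex.normSq b := by
      intro a b
      rw [Complex.div_re, Complex.mul_re, Complex.conj_re, Complex.conj_im]
      ring
    have h1 := Complex.re_nonneg_of_forall_sphere (g := fun x => dslope T w x / dslope q w x) hr
      ((((Complex.differentiableOn_dslope (hDo.mem_nhds hwD)).2 hTd).mono hsub).div
        (((Complex.differentiableOn_dslope (hDo.mem_nhds hwD)).2 hq).mono hsub)
        hq0 |>.diffContOnCl_ball subset_rfl) (fun x hx => ?_) (mem_ball_zero_iff.2 hlt)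
    · have hne : z ≠ w := by
        rintro rfl
        exact lt_irrefl _ hlt
      have hqne : q w - q z ≠ 0 := by
        intro h
        have := hc.support hq hw hlt.le hne
        rw [h] at this
        simp at this
      simp only [hquot z hne, hmr] at h1
      have h2 := mul_nonneg h1 (Complex.normSq_nonneg (q w - q z))
      rwa [div_mul_cancel₀ _ (Complex.normSq_pos.2 hqne).ne'] at h2
    · rcases eq_or_ne x w with rfl | hxw
      · simp only [dslope_same]
        have h2 : deriv T x = deriv q x + x * deriv (deriv q) x := by
          have h3 := (hasDerivAt_id x).mul
            (((hq.deriv hDo).differentiableAt (hDo.mem_nhds hwD)).hasDerivAt)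
          simp only [id, one_mul] at h3
          exact h3.deriv
        have h3 := (hc x hwD).2
        rw [h2, add_div, div_self (hc x hwD).1]
        linarith
      · simp only [hquot x hxw, hmr]
        exact div_nonneg (hcirc x (by simpa using hx)) (Complex.normSq_nonneg _)
  · exact hcirc z heq

/-- The functions `q + τ z q'`, `τ ≥ 0`, are univalent, and they form a subordination chain: the
value at `w` for a larger parameter is not taken at any other `z` with `‖z‖ ≤ ‖w‖` for a smaller
one. By the two-point estimates, the difference of the two values has a positive real inner product
with `q w - q z`. -/
theorem add_mul_deriv_ne (hc : ConvexityCondition 0 q)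
    (hq : DifferentiableOn ℂ q (Metric.ball 0 1)) {z w : ℂ} (hw : ‖w‖ < 1) (hzw : ‖z‖ ≤ ‖w‖)
    (hne : z ≠ w) {τ τ' : ℝ} (hτ : 0 ≤ τ) (hτ' : τ ≤ τ') :
    q z + τ * (z * deriv q z) ≠ q w + τ' * (w * deriv q w) := by
  intro h
  have h1 := hc.support hq hw hzw hne
  have h2 := hc.monotone_mul_deriv hq hw hzw
  have h3 : q w - q z ≠ 0 := by
    intro h
    rw [h] at h1
    simp at h1
  have h4 : starRingEnd ℂ (q w - q z) * (q w - q z) +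
      τ * (starRingEnd ℂ (q w - q z) * (w * deriv q w - z * deriv q z)) +
      ((τ' - τ : ℝ) : ℂ) * (starRingEnd ℂ (q w - q z) * (w * deriv q w)) = 0 := by
    push_cast
    linear_combination -(starRingEnd ℂ (q w - q z)) * h
  have h5 := congrArg Complex.re h4
  rw [← Complex.normSq_eq_conj_mul_self, Complex.add_re, Complex.add_re, Complex.re_ofReal_mul,
    Complex.re_ofReal_mul, Complex.ofReal_re, Complex.zero_re] at h5
  have h6 : (starRingEnd ℂ (q w - q z) * (w * deriv q w)).re =
      (starRingEnd ℂ (w * deriv q w) * (q w - q z)).re := by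
    simp only [Complex.mul_re, Complex.conj_re, Complex.conj_im]
    ring
  rw [h6] at h5
  have h7 := Complex.normSq_pos.2 h3
  have h8 := mul_nonneg hτ h2
  have h9 := mul_nonneg (sub_nonneg.2 hτ') h1.le
  linarith

end ConvexityCondition

/-! ### The differential subordination and superordination -/

namespace ConvexityCondition

variable {q : ℂ → ℂ}

theorem univalentOnDisk_add_mul_deriv (hc : ConvexityCondition 0 q)
    (hq : DifferentiableOn ℂ q (Metric.ball 0 1)) {τ : ℝ} (hτ : 0 ≤ τ) :
    UnivalentOnDisk fun z => q z + τ * (z * deriv q z) := by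
  refine ⟨hq.add ((differentiableOn_id.mul (hq.deriv Metric.isOpen_ball)).const_mul _),
    fun z hz w hw h => ?_⟩
  rw [mem_ball_zero_iff] at hz hw
  by_contra hne
  rcases le_total ‖z‖ ‖w‖ with hzw | hzw
  · exact hc.add_mul_deriv_ne hq hw hzw hne hτ le_rfl h
  · exact hc.add_mul_deriv_ne hq hz hzw (Ne.symm hne) hτ le_rfl h.symm

theorem univalentOnDisk (hc : ConvexityCondition 0 q)
    (hq : DifferentiableOn ℂ q (Metric.ball 0 1)) : UnivalentOnDisk q := by
  simpa using hc.univalentOnDisk_add_mul_deriv hq le_rfl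

/-- The range of `q + τ z q'` on a disk about the origin grows with `τ`: it is connected, and by
`add_mul_deriv_ne` it does not meet the boundary of the range for the larger parameter. -/
theorem exists_add_mul_deriv_eq (hc : ConvexityCondition 0 q)
    (hq : DifferentiableOn ℂ q (Metric.ball 0 1)) {ρ : ℝ} (hρ : ρ < 1) {z : ℂ} (hz : ‖z‖ < ρ)
    {τ τ' : ℝ} (hτ : 0 ≤ τ) (hτ' : τ ≤ τ') :
    ∃ x : ℂ, ‖x‖ < ρ ∧ q x + τ' * (x * deriv q x) = q z + τ * (z * deriv q z) := by
  have hsub : Metric.ball (0 : ℂ) ρ ⊆ Metric.ball 0 1 := Metric.ball_subset_ball hρ.le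
  have hsub' : Metric.closedBall (0 : ℂ) ρ ⊆ Metric.ball 0 1 := Metric.closedBall_subset_ball hρ
  have h0 : (0 : ℂ) ∈ Metric.ball (0 : ℂ) ρ := by
    simpa using (norm_nonneg z).trans_lt hz
  have hU := hc.univalentOnDisk_add_mul_deriv hq hτ
  have hU' := hc.univalentOnDisk_add_mul_deriv hq (hτ.trans hτ')
  have hincl : (fun z => q z + τ * (z * deriv q z)) '' Metric.ball 0 ρ ⊆
      (fun z => q z + τ' * (z * deriv q z)) '' Metric.ball 0 ρ := by
    refine IsPreconnected.subset_of_closure_inter_subset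
      ((convex_ball (0 : ℂ) ρ).isPreconnected.image _ (hU.1.continuousOn.mono hsub))
      (hU'.isOpen_image hsub Metric.isOpen_ball) ⟨q 0, ⟨0, h0, by simp⟩, ⟨0, h0, by simp⟩⟩ ?_
    rintro y ⟨hy, ⟨x, hx, hxy⟩⟩
    have hK : IsClosed ((fun z => q z + τ' * (z * deriv q z)) '' Metric.closedBall 0 ρ) :=
      ((isCompact_closedBall (0 : ℂ) ρ).image_of_continuousOn
        (hU'.1.continuousOn.mono hsub')).isClosed
    obtain ⟨ζ, hζ, hζy⟩ := closure_minimal (Set.image_mono Metric.ball_subset_closedBall) hK hy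
    have hζ1 : ‖ζ‖ < 1 := mem_ball_zero_iff.1 (hsub' hζ)
    rw [mem_ball_zero_iff] at hx
    rw [mem_closedBall_zero_iff] at hζ
    rcases hζ.lt_or_eq with hlt | heq
    · exact ⟨ζ, mem_ball_zero_iff.2 hlt, hζy⟩
    · have hlt : ‖x‖ < ‖ζ‖ := by rwa [heq]
      exact absurd (hxy.trans hζy.symm) (hc.add_mul_deriv_ne hq hζ1 hlt.le
        (fun h => lt_irrefl _ (h ▸ hlt)) hτ hτ')
  obtain ⟨x, hx, hxz⟩ := hincl ⟨z, mem_ball_zero_iff.2 hz, rfl⟩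
  exact ⟨x, mem_ball_zero_iff.1 hx, hxz⟩

/-- If `P + β z P' ≺ q + β z q'` with `q` convex, then `P ≺ q`: by the lemma of Miller and Mocanu
the failure of `P ≺ q` produces a value `q ζ + β m ζ q'(ζ)`, `m ≥ 1`, of `P + β z P'` at a point of
smaller modulus than `ζ`, against `add_mul_deriv_ne`. -/
theorem subordinate_of_add_mul_deriv (hc : ConvexityCondition 0 q)
    (hq : DifferentiableOn ℂ q (Metric.ball 0 1)) {β : ℝ} (hβ : 0 ≤ β) {P : ℂ → ℂ}
    (hP : DifferentiableOn ℂ P (Metric.ball 0 1))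
    (hsub : Subordinate (fun z => P z + β * (z * deriv P z))
      fun z => q z + β * (z * deriv q z)) : Subordinate P q := by
  obtain ⟨w, -, hw⟩ := hsub
  refine subordinate_of_forall_ne hP (hc.univalentOnDisk hq) ?_ ?_
  · obtain ⟨h1, h2⟩ := hw 0 (by simp)
    rw [norm_zero, norm_le_zero_iff] at h1
    simpa [h1] using h2
  · intro z hz ζ hζ hlt hPz m hm hd
    obtain ⟨h1, h2⟩ := hw z hz
    rw [mem_ball_zero_iff] at hζ
    have h3 := h1.trans_lt hlt
    refine hc.add_mul_deriv_ne hq hζ h3.le (fun h => lt_irrefl _ (h ▸ h3)) hβ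
      (le_mul_of_one_le_right hβ hm) (h2.symm.trans ?_)
    simp only [hPz, hd]
    push_cast
    ring

/-- If `q + β z q' ≺ P + β z P'` with `q` convex and `P`, `P + β z P'` univalent, then `q ≺ P`: by
the lemma of Miller and Mocanu the failure of `q ≺ P` produces a value `q z + (β / m) z q'(z)`,
`m ≥ 1`, of `P + β z P'` at a point of larger modulus than `z`. By `exists_add_mul_deriv_eq` and the
subordination this value is also taken near the disk of radius `‖z‖`. -/
theorem subordinate_of_add_mul_deriv_univalent (hc : ConvexityCondition 0 q)
    (hq : DifferentiableOn ℂ q (Metric.ball 0 1)) {β : ℝ} (hβ : 0 ≤ β) {P : ℂ → ℂ}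
    (hP : UnivalentOnDisk P) (hG : UnivalentOnDisk fun z => P z + β * (z * deriv P z))
    (hsub : Subordinate (fun z => q z + β * (z * deriv q z))
      fun z => P z + β * (z * deriv P z)) : Subordinate q P := by
  obtain ⟨w, -, hw⟩ := hsub
  refine subordinate_of_forall_ne hq hP ?_ ?_
  · obtain ⟨h1, h2⟩ := hw 0 (by simp)
    rw [norm_zero, norm_le_zero_iff] at h1
    simpa [h1] using h2
  · intro z _ ζ hζ hlt hPz m hm hd
    have hm0 : 0 < m := zero_lt_one.trans_le hm
    obtain ⟨x, hx, hxz⟩ := hc.exists_add_mul_deriv_eq hq (mem_ball_zero_iff.1 hζ) hlt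
      (div_nonneg hβ hm0.le) (div_le_self hβ hm)
    have hx1 : x ∈ Metric.ball (0 : ℂ) 1 :=
      mem_ball_zero_iff.2 (hx.trans (mem_ball_zero_iff.1 hζ))
    obtain ⟨h1, h2⟩ := hw x hx1
    have hwx : w x ∈ Metric.ball (0 : ℂ) 1 :=
      mem_ball_zero_iff.2 (h1.trans_lt (mem_ball_zero_iff.1 hx1))
    have hEq : ζ = w x := by
      refine hG.2 hζ hwx (Eq.trans ?_ h2)
      simp only [hxz, hPz, hd]
      have hmC : (m : ℂ) ≠ 0 := by exact_mod_cast hm0.ne'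
      push_cast
      field_simp
    rw [← hEq] at h1
    linarith

end ConvexityCondition

theorem Subordinate.congr {f f' F F' : ℂ → ℂ} (h : Subordinate f F)
    (hf : Set.EqOn f f' (Metric.ball 0 1)) (hF : Set.EqOn F F' (Metric.ball 0 1)) :
    Subordinate f' F' := by
  obtain ⟨w, hwd, hw⟩ := h
  refine ⟨w, hwd, fun z hz => ⟨(hw z hz).1, ?_⟩⟩
  rw [← hf hz, (hw z hz).2]
  refine hF (mem_ball_zero_iff.2 ((hw z hz).1.trans_lt (mem_ball_zero_iff.1 hz)))

theorem Subordinate.refl (f : ℂ → ℂ) : Subordinate f f :=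
  ⟨id, differentiableOn_id, fun _ _ => ⟨le_rfl, rfl⟩⟩

theorem UnivalentOnDisk.congr {f f' : ℂ → ℂ} (h : UnivalentOnDisk f)
    (hf : Set.EqOn f f' (Metric.ball 0 1)) : UnivalentOnDisk f' :=
  ⟨h.1.congr hf.symm, h.2.congr hf⟩

/-- Since `q` itself solves `P + β z P' ≺ h`, it is the best dominant as soon as it is a dominant. -/
theorem ConvexityCondition.isBestDominant {q h : ℂ → ℂ} (hc : ConvexityCondition 0 q)
    (hq : DifferentiableOn ℂ q (Metric.ball 0 1)) {β : ℝ} (hβ : 0 ≤ β)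
    (hh : Set.EqOn (fun z => q z + β * (z * deriv q z)) h (Metric.ball 0 1)) :
    IsBestDominant (fun u v => u + β * v) h q :=
  ⟨(hc.univalentOnDisk_add_mul_deriv hq hβ).congr hh,
    ⟨hc.univalentOnDisk hq, fun _ hP =>
      hc.subordinate_of_add_mul_deriv hq hβ hP.1 (hP.2.congr (Set.eqOn_refl _ _) hh.symm)⟩,
    fun _ hq' => hq'.2 q ⟨hq, (Subordinate.refl h).congr hh.symm (Set.eqOn_refl _ _)⟩⟩

/-- Since `q` itself solves `h ≺ P + β z P'`, it is the best subordinant as soon as it is a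
subordinant. -/
theorem ConvexityCondition.isBestSubordinant {q h : ℂ → ℂ} (hc : ConvexityCondition 0 q)
    (hq : DifferentiableOn ℂ q (Metric.ball 0 1)) {β : ℝ} (hβ : 0 ≤ β)
    (hh : Set.EqOn (fun z => q z + β * (z * deriv q z)) h (Metric.ball 0 1)) :
    IsBestSubordinant (fun u v => u + β * v) h q :=
  ⟨((hc.univalentOnDisk_add_mul_deriv hq hβ).congr hh).1, hc.univalentOnDisk hq,
    ⟨hq, fun _ hP => hc.subordinate_of_add_mul_deriv_univalent hq hβ hP.1 hP.2.1
      (hP.2.2.congr hh.symm (Set.eqOn_refl _ _))⟩,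
    fun _ hq' => hq'.2 q ⟨hc.univalentOnDisk hq, hc.univalentOnDisk_add_mul_deriv hq hβ,
      (Subordinate.refl h).congr (Set.eqOn_refl _ _) hh.symm⟩⟩

/-! ### The Bessel operator -/

theorem exists_norm_taylorCoeffZero_le {f : ℂ → ℂ} (hf : DifferentiableOn ℂ f (Metric.ball 0 1)) :
    ∃ C : ℝ, ∀ n, ‖taylorCoeffZero f n‖ ≤ C * 2 ^ n := by
  have hsub : Metric.closedBall (0 : ℂ) (1 / 2) ⊆ Metric.ball 0 1 :=
    Metric.closedBall_subset_ball (by norm_num)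
  obtain ⟨C, hC⟩ := (isCompact_closedBall (0 : ℂ) (1 / 2)).exists_bound_of_continuousOn
    (hf.continuousOn.mono hsub)
  refine ⟨C, fun n => ?_⟩
  have := Complex.norm_iteratedDeriv_le_of_forall_mem_sphere_norm_le n (c := 0) (R := 1 / 2)
    (by norm_num) ((hf.mono hsub).diffContOnCl_ball subset_rfl)
    fun z hz => hC z (Metric.sphere_subset_closedBall hz)
  rw [taylorCoeffZero, norm_div, Complex.norm_natCast, div_le_iff₀ (by positivity)]
  calc _ ≤ _ := this
    _ = _ := by rw [div_pow, one_pow]; field_simp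

/-- The power series of `B_{κ,c}(f)(z) / z`. -/
noncomputable def besselQuotient (κ : ℝ) (c : ℂ) (f : ℂ → ℂ) (z : ℂ) : ℂ :=
  ∑' n : ℕ, taylorCoeffZero f (n + 1) * besselCoeff κ c n * z ^ n

section BesselQuotient

variable {κ : ℝ} {f : ℂ → ℂ}

theorem summable_norm_besselQuotient (hκ : 0 < κ) (c : ℂ)
    (hf : DifferentiableOn ℂ f (Metric.ball 0 1)) :
    Summable fun n : ℕ => ‖taylorCoeffZero f (n + 1) * besselCoeff κ c n‖ := by
  obtain ⟨C, hC⟩ := exists_norm_taylorCoeffZero_le hf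
  refine Summable.of_nonneg_of_le (fun n => norm_nonneg _) (fun n => ?_)
    ((summable_besselCoeff hκ c 2).mul_left (2 * C))
  rw [norm_mul, Complex.norm_ofNat]
  calc _ ≤ C * 2 ^ (n + 1) * ‖besselCoeff κ c n‖ := by gcongr; exact hC _
    _ = _ := by ring

theorem norm_besselQuotient_term_le (c : ℂ) (n : ℕ) {z : ℂ} (hz : z ∈ Metric.ball (0 : ℂ) 1) :
    ‖taylorCoeffZero f (n + 1) * besselCoeff κ c n * z ^ n‖ ≤
      ‖taylorCoeffZero f (n + 1) * besselCoeff κ c n‖ := by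
  rw [norm_mul, norm_pow]
  exact mul_le_of_le_one_right (norm_nonneg _)
    (pow_le_one₀ (norm_nonneg _) (mem_ball_zero_iff.1 hz).le)

theorem differentiableOn_besselQuotient (hκ : 0 < κ) (c : ℂ)
    (hf : DifferentiableOn ℂ f (Metric.ball 0 1)) :
    DifferentiableOn ℂ (besselQuotient κ c f) (Metric.ball 0 1) :=
  Complex.differentiableOn_tsum_of_summable_norm (summable_norm_besselQuotient hκ c hf)
    (fun _ => (differentiable_pow _).differentiableOn.const_mul _) Metric.isOpen_ball
    fun n _ hz => norm_besselQuotient_term_le c n hz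

theorem hasSum_besselQuotient (hκ : 0 < κ) (c : ℂ)
    (hf : DifferentiableOn ℂ f (Metric.ball 0 1)) {z : ℂ} (hz : z ∈ Metric.ball (0 : ℂ) 1) :
    HasSum (fun n : ℕ => taylorCoeffZero f (n + 1) * besselCoeff κ c n * z ^ n)
      (besselQuotient κ c f z) :=
  (Summable.of_norm_bounded (summable_norm_besselQuotient hκ c hf)
    fun n => norm_besselQuotient_term_le c n hz).hasSum

theorem hasSum_mul_deriv_besselQuotient (hκ : 0 < κ) (c : ℂ)
    (hf : DifferentiableOn ℂ f (Metric.ball 0 1)) {z : ℂ} (hz : z ∈ Metric.ball (0 : ℂ) 1) :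
    HasSum (fun n : ℕ => taylorCoeffZero f (n + 1) * besselCoeff κ c n * (n * z ^ n))
      (z * deriv (besselQuotient κ c f) z) := by
  have h := (Complex.hasSum_deriv_of_summable_norm (summable_norm_besselQuotient hκ c hf)
    (fun n => (differentiable_pow n).differentiableOn.const_mul _) Metric.isOpen_ball
    (fun n _ hz => norm_besselQuotient_term_le c n hz) hz).mul_left z
  refine h.congr_fun fun n => ?_
  rw [deriv_const_mul_field, deriv_pow_field]
  rcases n with _ | n
  · simp
  · rw [Nat.add_sub_cancel, pow_succ]
    ring

theorem overZ_besselOp (hκ : 0 < κ) (c : ℂ) (hf : DifferentiableOn ℂ f (Metric.ball 0 1)) (z : ℂ) :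
    overZ (besselOp κ c f) z = besselQuotient κ c f z := by
  have hB : besselOp κ c f = fun z => z * besselQuotient κ c f z := by
    funext z
    rw [besselOp_eq_tsum hκ, besselQuotient, ← tsum_mul_left]
    exact tsum_congr fun n => by ring
  rw [overZ, hB]
  split_ifs with hz
  · subst hz
    have h0 : (0 : ℂ) ∈ Metric.ball (0 : ℂ) 1 := by simp
    have h := (hasDerivAt_id (0 : ℂ)).mul (((differentiableOn_besselQuotient hκ c
      hf).differentiableAt (Metric.isOpen_ball.mem_nhds h0)).hasDerivAt)
    simp only [id, one_mul, zero_mul, add_zero] at h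
    exact h.deriv
  · rw [mul_div_cancel_left₀ _ hz]

end BesselQuotient

theorem besselCoeff_eq_mul_besselCoeff_add_one {κ : ℝ} (hκ : 0 < κ) (c : ℂ) (n : ℕ) :
    κ * besselCoeff κ c n = (κ + n) * besselCoeff ((κ + 1 : ℝ) : ℂ) c n := by
  have hpos : ∀ k : ℝ, 0 < k → (ascPochhammer ℂ n).eval (k : ℂ) ≠ 0 := by
    intro k hk
    have h1 := ascPochhammer_pos n k hk
    have h2 : (ascPochhammer ℂ n).eval (k : ℂ) = ((ascPochhammer ℝ n).eval k : ℝ) := by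
      rw [← ascPochhammer_map Complex.ofRealHom n, Polynomial.eval_map,
        ← Complex.ofRealHom_eq_coe, Polynomial.eval₂_at_apply, Complex.ofRealHom_eq_coe]
    rw [h2]
    exact_mod_cast h1.ne'
  have h1 := ascPochhammer_succ_eval (S := ℂ) n (κ : ℂ)
  rw [ascPochhammer_succ_left, Polynomial.eval_mul, Polynomial.eval_X, Polynomial.eval_comp] at h1
  simp only [Polynomial.eval_add, Polynomial.eval_X, Polynomial.eval_one] at h1
  have h2 := hpos κ hκ
  have h3 := hpos (κ + 1) (by linarith)
  have hfac : (n.factorial : ℂ) ≠ 0 := by exact_mod_cast n.factorial_ne_zero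
  rw [besselCoeff, besselCoeff]
  push_cast at h3 ⊢
  rw [mul_div_assoc', mul_div_assoc', div_eq_div_iff (mul_ne_zero h2 hfac) (mul_ne_zero h3 hfac)]
  linear_combination (-c / 4) ^ n * n.factorial * h1

/-- The recurrence `κ (κ + 1)ₙ = (κ + n) (κ)ₙ` turns the combination of two operators into the first
order differential operator `φ + β z φ'` applied to the second. -/
theorem besselComb_eq {κ lam : ℝ} (hκ : 0 < κ + 1) (c : ℂ) {f : ℂ → ℂ}
    (hf : DifferentiableOn ℂ f (Metric.ball 0 1)) {z : ℂ} (hz : z ∈ Metric.ball (0 : ℂ) 1) :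
    besselComb κ lam c f z = overZ (besselOp (κ + 2) c f) z +
      ((1 - lam) / (κ + 1) : ℝ) * (z * deriv (overZ (besselOp (κ + 2) c f)) z) := by
  have hκ2 : 0 < κ + 2 := by linarith
  have e1 : overZ (besselOp (κ + 1) c f) = besselQuotient (κ + 1) c f := by
    funext x
    simpa using overZ_besselOp hκ c hf x
  have e2 : overZ (besselOp (κ + 2) c f) = besselQuotient (κ + 2) c f := by
    funext x
    simpa using overZ_besselOp hκ2 c hf x
  rw [besselComb, e1, e2]
  have hl := ((hasSum_besselQuotient hκ c hf hz).mul_left (1 - lam : ℂ)).add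
    ((hasSum_besselQuotient hκ2 c hf hz).mul_left (lam : ℂ))
  have hr := (hasSum_besselQuotient hκ2 c hf hz).add
    ((hasSum_mul_deriv_besselQuotient hκ2 c hf hz).mul_left (((1 - lam) / (κ + 1) : ℝ) : ℂ))
  refine hl.unique (hr.congr_fun fun n => ?_)
  have h1 := besselCoeff_eq_mul_besselCoeff_add_one hκ c n
  rw [show κ + 1 + 1 = κ + 2 by ring] at h1
  have h0 : ((κ : ℂ) + 1) ≠ 0 := by exact_mod_cast hκ.ne'
  push_cast at h1 ⊢
  have h2 : besselCoeff ((κ : ℂ) + 1) c n =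
      (κ + 1 + n) * besselCoeff ((κ : ℂ) + 2) c n / (κ + 1) := by
    rw [eq_div_iff h0, mul_comm, h1]
  rw [h2]
  field_simp
  ring

theorem differentiableOn_overZ_besselOp {κ : ℝ} (hκ : 0 < κ + 2) (c : ℂ) {f : ℂ → ℂ}
    (hf : DifferentiableOn ℂ f (Metric.ball 0 1)) :
    DifferentiableOn ℂ (overZ (besselOp (κ + 2) c f)) (Metric.ball 0 1) := by
  have e2 : overZ (besselOp (κ + 2) c f) = besselQuotient (κ + 2) c f := by
    funext x
    simpa using overZ_besselOp hκ c hf x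
  rw [e2]
  exact differentiableOn_besselQuotient hκ c hf

theorem two_mul_gammaConst_le {κ lam : ℝ} (hκ : 0 < κ + 1) (hlam : lam < 1) :
    2 * gammaConst lam κ ≤ (1 - lam) / (κ + 1) := by
  have hA : 0 < 1 - lam := by linarith
  have hs : (κ + 1) ^ 2 ≤ √((1 - lam) ^ 4 + (κ + 1) ^ 4) :=
    Real.le_sqrt_of_sq_le (by nlinarith [pow_pos hA 4])
  rw [gammaConst, mul_div_assoc', div_le_div_iff₀ (by positivity) hκ]
  nlinarith [mul_pos hκ (pow_pos hA 2), mul_nonneg hκ.le (sub_nonneg.2 hs)]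

theorem two_mul_gammaConst_mul_le {κ lam : ℝ} (hκ : 0 < κ + 1) (hlam : lam < 1) :
    2 * gammaConst lam κ * ((1 - lam) / (κ + 1)) ≤ 1 := by
  have hA : 0 < 1 - lam := by linarith
  have hs : (1 - lam) ^ 2 ≤ √((1 - lam) ^ 4 + (κ + 1) ^ 4) :=
    Real.le_sqrt_of_sq_le (by nlinarith [pow_pos hκ 4])
  rw [gammaConst, mul_div_assoc' (2 : ℝ), div_mul_div_comm, div_le_one (by positivity)]
  nlinarith [mul_pos hA (pow_pos hκ 2), mul_nonneg hA.le (sub_nonneg.2 hs)]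

theorem convexityCondition_overZ_besselOp {κ lam : ℝ} (hκ : 0 < κ + 1) (hlam : lam < 1) {c : ℂ}
    {g : ℂ → ℂ} (hg : DifferentiableOn ℂ g (Metric.ball 0 1))
    (hΦ : ConvexityCondition (gammaConst lam κ) (besselComb κ lam c g)) :
    ConvexityCondition 0 (overZ (besselOp (κ + 2) c g)) :=
  hΦ.of_add_mul_deriv (div_pos (sub_pos.2 hlam) hκ) (two_mul_gammaConst_le hκ hlam)
    (two_mul_gammaConst_mul_le hκ hlam) (differentiableOn_overZ_besselOp (by linarith) c hg)
    fun _ hz => besselComb_eq hκ c hg hz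

theorem mainTheorem4 (f g₁ g₂ : ℂ → ℂ) (hf : ClassA f) (hg₁ : ClassA g₁) (hg₂ : ClassA g₂)
    (p b κ lam : ℝ) (c : ℂ) (hκ : κ = p + (b + 1) / 2) (hκ1 : -1 < κ)
    (hlam0 : 0 ≤ lam) (hlam1 : lam < 1) (hc : c ≠ 0)
    (hΦ₁ : ConvexityCondition (gammaConst lam κ) (besselComb κ lam c g₁))
    (hΦ₂ : ConvexityCondition (gammaConst lam κ) (besselComb κ lam c g₂))
    (hF : UnivalentOnDisk (besselComb κ lam c f))
    (hH : ClassH 1 1 (overZ (besselOp (κ + 2) c f)))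
    (hQ : ClassQ (overZ (besselOp (κ + 2) c f))) :
    (Subordinate (besselComb κ lam c g₁) (besselComb κ lam c f) →
      Subordinate (besselComb κ lam c f) (besselComb κ lam c g₂) →
        Subordinate (overZ (besselOp (κ + 2) c g₁)) (overZ (besselOp (κ + 2) c f)) ∧
        Subordinate (overZ (besselOp (κ + 2) c f)) (overZ (besselOp (κ + 2) c g₂))) ∧
    IsBestSubordinant (fun u v => u + ((1 - lam) / (κ + 1) : ℂ) * v)
      (besselComb κ lam c g₁) (overZ (besselOp (κ + 2) c g₁)) ∧
    IsBestDominant (fun u v => u + ((1 - lam) / (κ + 1) : ℂ) * v)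
      (besselComb κ lam c g₂) (overZ (besselOp (κ + 2) c g₂)) := by
  have hκ' : 0 < κ + 1 := by linarith
  have hβ : 0 ≤ (1 - lam) / (κ + 1) := div_nonneg (sub_pos.2 hlam1).le hκ'.le
  have hcomb : ∀ {h : ℂ → ℂ}, ClassA h → Set.EqOn (fun z => overZ (besselOp (κ + 2) c h) z +
      ((1 - lam) / (κ + 1) : ℝ) * (z * deriv (overZ (besselOp (κ + 2) c h)) z))
      (besselComb κ lam c h) (Metric.ball 0 1) :=
    fun hh _ hz => (besselComb_eq hκ' c hh.1.1 hz).symm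
  have hsub := (convexityCondition_overZ_besselOp hκ' hlam1 hg₁.1.1 hΦ₁).isBestSubordinant
    (differentiableOn_overZ_besselOp (by linarith) c hg₁.1.1) hβ (hcomb hg₁)
  have hdom := (convexityCondition_overZ_besselOp hκ' hlam1 hg₂.1.1 hΦ₂).isBestDominant
    (differentiableOn_overZ_besselOp (by linarith) c hg₂.1.1) hβ (hcomb hg₂)
  set φ := overZ (besselOp (κ + 2) c f)
  have hφ : UnivalentOnDisk φ := by
    -- the exceptional set lies on the unit circle
    refine ⟨hH.1, hQ.2.1.mono fun z hz => ?_⟩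
    refine Set.mem_sdiff_of_mem (Metric.ball_subset_closedBall hz) fun h => ?_
    rw [mem_ball_zero_iff] at hz
    exact hz.ne (mem_sphere_zero_iff_norm.1 h.1)
  refine ⟨fun h₁ h₂ => ⟨?_, ?_⟩, ?_, ?_⟩
  · exact hsub.2.2.1.2 φ ⟨hφ, hF.congr (hcomb hf).symm,
      h₁.congr (Set.eqOn_refl _ _) (hcomb hf).symm⟩
  · exact hdom.2.1.2 φ ⟨hH.1, h₂.congr (hcomb hf).symm (Set.eqOn_refl _ _)⟩
  · simpa using hsub
  · simpa using hdom
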